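/- **Setting.** Let $m$ be a positive multiple of $4$ and $[m]=\{1,\dots,m\}$. In the Set-Intersection problem, Alice holds $X\subseteq[m]$ and Bob holds $Y\subseteq[m]$ with $X\cap Y=\{e^*\}$, and they want to find $e^*$. The distribution $\mathcal D_m$ on inputs $(X,Y)$ is: choose a uniformly random pair $(X',Y')$ of disjoint subsets of $[m]$ of size $\frac m4-1$, choose $e^*\in[m]\setminus(X'\cup Y')$ uniformly, and put $X=X'\cup\{e^*\}$, $Y=Y'\cup\{e^*\}$. Protocols are finite two-party communication protocols with (finite) public and private randomness, in which at the end one of the players computes the answer from the public randomness, the messages, and that player's own input and private randomness. $\Pi$ denotes the transcript of messages together with the public randomness. The (internal) information cost of $\pi$ on $\mathcal D_m$ is, in bits, $$\mathrm{IC}(\pi,\mathcal D_m)=I(\Pi;X\mid Y)+I(\Pi;Y\mid X).$$ For distributions $\mu,\nu$ on a finite set, the positive triangular discrimination is $\Lambda(\mu,\nu)=\sum_{x:\,\mu(x)>\nu(x)}\frac{(\mu(x)-\nu(x))^2}{\mu(x)+\nu(x)}$. Write $\mu(e^*\mid\cdot)$ for the conditional distribution of $e^*$. A protocol *internally $\varepsilon$-solves*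 Set-Intersection on $\mathcal D_m$ if $$\mathbb E_{\Pi,X}\,\Lambda\big(\mu(e^*\mid\Pi,X),\mu(e^*\mid X)\big)\ge\varepsilon\quad\text{or}\quad \mathbb E_{\Pi,Y}\,\Lambda\big(\mu(e^*\mid\Pi,Y),\mu(e^*\mid Y)\big)\ge\varepsilon .$$ A protocol *exactly solves* Set-Intersection on $\mathcal D_m$ if its answer equals $e^*$ with probability $1$ over the inputs and all randomness. **Theorem.** 1. For every $\gamma\in(0,1)$ there is a constant $c\ge1$ (depending only on $\gamma$) such that for every positive multiple $m$ of $4$, every real $\varepsilon\ge 8/m$ and every protocol $\pi_{\mathrm{SI}}$ that internally $\varepsilon$-solves Set-Intersection on $\mathcal D_m$, there is a protocol $\pi$ that exactly solves Set-Intersection on $\mathcal D_m$ with $$\mathrm{IC}(\pi,\mathcal D_m)\le\frac c\varepsilon\,\mathrm{IC}(\pi_{\mathrm{SI}},\mathcal D_m)+\gamma m .$$ 2. There is an absolute constant $c>0$ such that for every positive multiple $m$ of $4$, every real $\varepsilon\ge 8/m$ and every protocol $\pi_{\mathrm{SI}}$ that internally $\varepsilon$-solves Set-Intersection on $\mathcal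 D_m$, $$\mathrm{IC}(\pi_{\mathrm{SI}},\mathcal D_m)\ge c\,\varepsilon\,m .$$ -/

import Mathlib

noncomputable section

namespace SetInt

/-! ### Finite probability: probabilities, entropy, mutual information -/

section Probability

variable {Ω α β κ : Type*} [Fintype Ω]

/-- Probability of an event. -/
def prob (p : PMF Ω) (E : Set Ω) : ℝ := (p.toOuterMeasure E).toReal

/-- Conditional probability of `E` given `F`. It is only ever used
with weight `prob p F` or at outcomes where `F` has positive probability. -/
def condProb (p : PMF Ω) (E F : Set Ω) : ℝ := prob p (E ∩ F) / prob p F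

/-- Expectation of a real random variable on a finite probability space. -/
def expect (p : PMF Ω) (f : Ω → ℝ) : ℝ := ∑ ω, (p ω).toReal * f ω

open scoped Classical in
/-- Shannon entropy `H(A | F)`, in bits, of `A` under the law conditioned on the event `F`. -/
def entropyGiven (p : PMF Ω) (A : Ω → α) (F : Set Ω) : ℝ :=
  ∑ a ∈ Finset.univ.image A,
    condProb p {ω | A ω = a} F * Real.logb 2 (1 / condProb p {ω | A ω = a} F)

open scoped Classical in
/-- Conditional entropy `H(A | B) = E_{b ∼ B} H(A | B = b)`. -/
def condEntropy (p : PMF Ω) (A : Ω → α) (B : Ω → β) : ℝ :=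
  ∑ b ∈ Finset.univ.image B, prob p {ω | B ω = b} * entropyGiven p A {ω | B ω = b}

/-- Conditional mutual information `I(A ; B | C) = H(A | C) - H(A | B, C)`. -/
def condMutualInfo (p : PMF Ω) (A : Ω → α) (B : Ω → β) (C : Ω → κ) : ℝ :=
  condEntropy p A C - condEntropy p A (fun ω => (B ω, C ω))

end Probability

open scoped Classical in
/-- Positive triangular discrimination of two distributions on a finite set, given by
their probability mass functions. -/
def ptd {α : Type*} [Fintype α] (μ ν : α → ℝ) : ℝ :=
  ∑ x with ν x < μ x, (μ x - ν x) ^ 2 / (μ x + ν x)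

/-! ### Two-party protocols with public and private randomness -/

/-- A protocol tree. At each inner node one player sends one bit, which is a function of that
player's input and private randomness (and of the node, i.e. of the messages so far). -/
inductive Tree (𝒳 𝒴 RA RB : Type) : Type
  | leaf : Tree 𝒳 𝒴 RA RB
  | alice (msg : 𝒳 → RA → Bool) (next : Bool → Tree 𝒳 𝒴 RA RB) : Tree 𝒳 𝒴 RA RB
  | bob (msg : 𝒴 → RB → Bool) (next : Bool → Tree 𝒳 𝒴 RA RB) : Tree 𝒳 𝒴 RA RB

/-- The bits exchanged when the tree is executed. -/
def Tree.run {𝒳 𝒴 RA RB : Type} : Tree 𝒳 𝒴 RA RB → 𝒳 → 𝒴 → RA → RB → List Bool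
  | .leaf, _, _, _, _ => []
  | .alice msg next, x, y, a, b => msg x a :: (next (msg x a)).run x y a b
  | .bob msg next, x, y, a, b => msg y b :: (next (msg y b)).run x y a b

/-- How the answer is produced: one of the players computes it from the public randomness, the
messages exchanged, and that player's own input and private randomness. -/
inductive OutputRule (𝒳 𝒴 𝒵 Pub RA RB : Type) : Type
  | byAlice (f : Pub → List Bool → 𝒳 → RA → 𝒵) : OutputRule 𝒳 𝒴 𝒵 Pub RA RB
  | byBob (f : Pub → List Bool → 𝒴 → RB → 𝒵) : OutputRule 𝒳 𝒴 𝒵 Pub RA RB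

/-- A randomized two-party protocol with inputs in `𝒳`, `𝒴` and answers in `𝒵`, using
public randomness `Pub` and private randomness `RA`, `RB`. The protocol tree
may depend arbitrarily on the public randomness. -/
structure Protocol (𝒳 𝒴 𝒵 : Type) where
  Pub : Type
  RA : Type
  RB : Type
  [fintypePub : Fintype Pub]
  [fintypeRA : Fintype RA]
  [fintypeRB : Fintype RB]
  pubLaw : PMF Pub
  aliceLaw : PMF RA
  bobLaw : PMF RB
  tree : Pub → Tree 𝒳 𝒴 RA RB
  output : OutputRule 𝒳 𝒴 𝒵 Pub RA RB

attribute [instance] Protocol.fintypePub Protocol.fintypeRA Protocol.fintypeRB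

namespace Protocol

variable {𝒳 𝒴 𝒵 : Type} (π : Protocol 𝒳 𝒴 𝒵)

/-- Outcomes of an execution: the inputs, the public randomness, and the two private
random strings. -/
abbrev Sample : Type := (𝒳 × 𝒴) × π.Pub × π.RA × π.RB

/-- The joint law of an execution on inputs drawn from `D`: the inputs, the public randomness and
the private random strings are mutually independent. -/
def law (D : PMF (𝒳 × 𝒴)) : PMF π.Sample :=
  D.bind fun xy => π.pubLaw.bind fun r => π.aliceLaw.bind fun a => π.bobLaw.map fun b =>
    (xy, r, a, b)

/-- Alice's input. -/
def inA (ω : π.Sample) : 𝒳 := ω.1.1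

/-- Bob's input. -/
def inB (ω : π.Sample) : 𝒴 := ω.1.2

/-- The messages exchanged. -/
def messages (ω : π.Sample) : List Bool :=
  (π.tree ω.2.1).run ω.1.1 ω.1.2 ω.2.2.1 ω.2.2.2

/-- The transcript, including the public randomness. -/
def transcript (ω : π.Sample) : π.Pub × List Bool := (ω.2.1, π.messages ω)

/-- The answer of the protocol. -/
def answer (ω : π.Sample) : 𝒵 :=
  match π.output with
  | .byAlice f => f ω.2.1 (π.messages ω) ω.1.1 ω.2.2.1
  | .byBob f => f ω.2.1 (π.messages ω) ω.1.2 ω.2.2.2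

/-- Internal information cost `I(Π ; X | Y) + I(Π ; Y | X)`. -/
def infoCost [Fintype 𝒳] [Fintype 𝒴] (D : PMF (𝒳 × 𝒴)) : ℝ :=
  condMutualInfo (π.law D) π.transcript π.inA π.inB
    + condMutualInfo (π.law D) π.transcript π.inB π.inA

end Protocol

/-! ### Set-Intersection -/

/-- Protocols for Set-Intersection over the universe `[m]`. -/
abbrev SIProtocol (m : ℕ) : Type 1 :=
  Protocol (Finset (Fin m)) (Finset (Fin m)) (Fin m)

/-- Pairs of disjoint subsets of `[m]`, each of size `m / 4 - 1`. -/
abbrev DisjointPair (m : ℕ) : Type :=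
  {s : Finset (Fin m) × Finset (Fin m) //
    s.1.card = m / 4 - 1 ∧ s.2.card = m / 4 - 1 ∧ Disjoint s.1 s.2}

instance (m : ℕ) : Nonempty (DisjointPair m) := by
  obtain ⟨s, -, hs⟩ := Finset.exists_subset_card_eq
    (s := (Finset.univ : Finset (Fin m))) (n := m / 4 - 1) (by simp; omega)
  obtain ⟨t, ht, htc⟩ := Finset.exists_subset_card_eq (s := sᶜ) (n := m / 4 - 1)
    (by rw [Finset.card_compl, hs, Fintype.card_fin]; omega)
  exact ⟨⟨(s, t), hs, htc, (Finset.disjoint_of_subset_left ht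
    (Finset.disjoint_left.2 fun a ha => by simpa using ha)).symm⟩⟩

theorem DisjointPair.compl_nonempty {m : ℕ} [NeZero m] (s : DisjointPair m) :
    ((s.1.1 ∪ s.1.2)ᶜ).Nonempty := by
  obtain ⟨⟨s, t⟩, hs, ht, -⟩ := s
  have h0 := NeZero.pos m
  have hu := Finset.card_union_le s t
  simp only at hs ht ⊢
  rw [← Finset.card_pos, Finset.card_compl, Fintype.card_fin]
  omega

/-- The hard distribution: sample a uniformly random pair `(X', Y')` of disjoint sets of size
`m / 4 - 1`, then a uniformly random `e` outside `X' ∪ Y'`, and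
return `(X' ∪ {e}, Y' ∪ {e})`. (Used for positive multiples `m` of `4`.) -/
def hardDist (m : ℕ) [NeZero m] : PMF (Finset (Fin m) × Finset (Fin m)) :=
  (PMF.uniformOfFintype (DisjointPair m)).bind fun s =>
    (PMF.uniformOfFinset (s.1.1 ∪ s.1.2)ᶜ s.compl_nonempty).map fun e =>
      (insert e s.1.1, insert e s.1.2)

namespace SIProtocol

variable {m : ℕ}

/-- The conditional distribution of the intersection point `e*` (where `X ∩ Y = {e*}`)
given the event `F`. -/
def pointLaw (π : SIProtocol m) (D : PMF (Finset (Fin m) × Finset (Fin m)))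
    (F : Set π.Sample) : Fin m → ℝ :=
  fun e => condProb (π.law D) {ω | π.inA ω ∩ π.inB ω = {e}} F

/-- `π` internally `ε`-solves Set-Intersection on `D`, with respect to positive triangular
discrimination: for Alice or for Bob, the expected distance between the law of `e*` given the
transcript and the player's input, and its law given the player's input alone, is
at least `ε`. -/
def InternallySolves (π : SIProtocol m) (D : PMF (Finset (Fin m) × Finset (Fin m)))
    (ε : ℝ) : Prop :=
  ε ≤ expect (π.law D) (fun ω =>
      ptd (pointLaw π D {ω' | π.transcript ω' = π.transcript ω ∧ π.inA ω' = π.inA ω})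
        (pointLaw π D {ω' | π.inA ω' = π.inA ω})) ∨
  ε ≤ expect (π.law D) (fun ω =>
      ptd (pointLaw π D {ω' | π.transcript ω' = π.transcript ω ∧ π.inB ω' = π.inB ω})
        (pointLaw π D {ω' | π.inB ω' = π.inB ω}))

/-- `π` exactly solves Set-Intersection on `D`: its answer is the intersection point with
probability one over the inputs and all of the randomness. -/
def ExactlySolves (π : SIProtocol m) (D : PMF (Finset (Fin m) × Finset (Fin m))) : Prop :=
  prob (π.law D) {ω | π.inA ω ∩ π.inB ω = {π.answer ω}} = 1

end SIProtocol

end SetInt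

end

open Finset

set_option linter.unusedSectionVars false

noncomputable section

namespace SetInt

/-! ### Scalar inequalities -/

/-! The heart is the lower bound `le_infoCost_of_internallySolves`: the cost is at least `ε * m /
768`. Part 1 follows from it without using the inside of the given protocol: announcing Alice's
whole set costs at most `2 * m` bits, already at most `1536 / ε` times the given cost.

For the lower bound, write `m = 4 * (n + 2)` and place a gadget of abstract positions on `[m]` by a
random bijection. Each player has `n` pairs of positions and takes one position of each pair by a
fair coin. One further coin chooses between the player's private position and position `1`, which is
shared by both players. Relabelling makes this coin indistinguishable from the other `n`. Relative
entropy is superadditive over independent coins (`sum_half_sq_sqrt_sub_le`), so exchanging private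
for shared position moves the transcript, on average, by a squared Hellinger distance of order cost
over `m` (`card_mul_sum_moveDist_le`).

Transcript probabilities factor as `α z x * β z y` for all inputs, including those outside the
support. Cut and paste can therefore pass through the input in which both players hold positions `0`
and `1`; it shows that the transcript barely distinguishes meeting at `0` from meeting at `1` when
Alice holds both (`moveDist_meeting_le`). Averaging over the rest of Bob's set, by joint convexity,
gives the same for any two elements of Alice's set (`sum_pointDist_le`).

Given `X`, the point `e*` is uniform on `X`. Triangular discrimination is at most twice the squared
Hellinger distance, and the distance to a uniform law is controlled by the average pairwise distance
(`IsModel.expect_ptd_le`). Hence `ε` is of order at most cost over `m`. -/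

theorem sub_add_sq_sqrt_le_mul_log {x y : ℝ} (hx : 0 ≤ x) (hy : 0 ≤ y) (h : y = 0 → x = 0) :
    x - y + (√x - √y) ^ 2 ≤ x * Real.log (x / y) := by
  rcases hx.eq_or_lt with rfl | hx
  · simp [Real.sq_sqrt hy]
  have hy' : 0 < y := hy.lt_of_ne fun h' => hx.ne' (h h'.symm)
  have h1 : Real.log (x / y) = -(2 * Real.log (√y / √x)) := by
    rw [Real.log_div hx.ne' hy'.ne', Real.log_div (by positivity) (by positivity),
      Real.log_sqrt hx.le, Real.log_sqrt hy]
    ring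
  -- Applying `log t ≤ t - 1` to the square root, rather than to `y / x`, is what leaves the
  -- Hellinger term.
  have h2 : Real.log (√y / √x) ≤ √y / √x - 1 := Real.log_le_sub_one_of_pos (by positivity)
  have h3 : x * (√y / √x) = √x * √y := by
    have : √x ≠ 0 := by positivity
    field_simp
    rw [Real.sq_sqrt hx.le]
  have h4 := mul_le_mul_of_nonneg_left h2 hx.le
  rw [mul_sub, h3] at h4
  rw [h1, sub_sq, Real.sq_sqrt hx.le, Real.sq_sqrt hy]
  linarith

theorem sub_le_mul_log {x y : ℝ} (hx : 0 ≤ x) (hy : 0 ≤ y) (h : y = 0 → x = 0) :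
    x - y ≤ x * Real.log (x / y) :=
  le_trans (by nlinarith [sq_nonneg (√x - √y)]) (sub_add_sq_sqrt_le_mul_log hx hy h)

/-- Compare both numbers with their midpoint: the linear terms cancel, and `a ^ 2 + b ^ 2 ≥ (a - b)
^ 2 / 2` merges the two distances to the midpoint. -/
theorem half_sq_sqrt_sub_le_mul_log {p q : ℝ} (hp : 0 ≤ p) (hq : 0 ≤ q) :
    (√p - √q) ^ 2 / 2 ≤
      p * Real.log (2 * p / (p + q)) + q * Real.log (2 * q / (p + q)) := by
  have h1 := sub_add_sq_sqrt_le_mul_log (x := p) (y := (p + q) / 2) hp (by positivity)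
    (fun h => by linarith)
  have h2 := sub_add_sq_sqrt_le_mul_log (x := q) (y := (p + q) / 2) hq (by positivity)
    (fun h => by linarith)
  rw [show p / ((p + q) / 2) = 2 * p / (p + q) by rw [div_div_eq_mul_div, mul_comm]] at h1
  rw [show q / ((p + q) / 2) = 2 * q / (p + q) by rw [div_div_eq_mul_div, mul_comm]] at h2
  nlinarith [sq_nonneg (√p + √q - 2 * √((p + q) / 2))]

theorem sq_sqrt_sub_sqrt {x y : ℝ} (hx : 0 ≤ x) (hy : 0 ≤ y) :
    (√x - √y) ^ 2 = x + y - 2 * (√x * √y) := by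
  rw [sub_sq, Real.sq_sqrt hx, Real.sq_sqrt hy]; ring

/-- Joint convexity of the squared Hellinger distance. -/
theorem sq_sqrt_sum_sub_le {ι : Type*} (s : Finset ι) {u v : ι → ℝ} (hu : ∀ i, 0 ≤ u i)
    (hv : ∀ i, 0 ≤ v i) :
    (√(∑ i ∈ s, u i) - √(∑ i ∈ s, v i)) ^ 2 ≤ ∑ i ∈ s, (√(u i) - √(v i)) ^ 2 := by
  rw [sq_sqrt_sub_sqrt (sum_nonneg fun i _ => hu i) (sum_nonneg fun i _ => hv i),
    sum_congr rfl fun i _ => sq_sqrt_sub_sqrt (hu i) (hv i), sum_sub_distrib, sum_add_distrib,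
    ← mul_sum]
  linarith [Real.sum_sqrt_mul_sqrt_le s hu hv]

/-- The passage from triangular discrimination to Hellinger distance: factor `u - v` through square
roots and use `(√u + √v) ^ 2 ≤ 2 * (u + v)`. -/
theorem sq_sub_div_add_le {u v : ℝ} (hu : 0 ≤ u) (hv : 0 ≤ v) :
    (u - v) ^ 2 / (u + v) ≤ 2 * (√u - √v) ^ 2 := by
  rcases (add_nonneg hu hv).eq_or_lt with h | h
  · rw [← h, div_zero]; positivity
  rw [div_le_iff₀ h]
  have h1 : u - v = (√u - √v) * (√u + √v) := by
    nlinarith [Real.sq_sqrt hu, Real.sq_sqrt hv]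
  have h2 : (√u + √v) ^ 2 ≤ 2 * (u + v) := by
    nlinarith [Real.sq_sqrt hu, Real.sq_sqrt hv, sq_nonneg (√u - √v)]
  rw [h1, mul_pow]
  nlinarith [mul_le_mul_of_nonneg_left h2 (sq_nonneg (√u - √v))]

/-- The squared Hellinger distance to an average is at most the average one. -/
theorem card_mul_sq_sqrt_sub_le {ι : Type*} (s : Finset ι) {u : ι → ℝ} (hu : ∀ i, 0 ≤ u i)
    {w : ℝ} (hw : 0 ≤ w) (hs : s.Nonempty) :
    (s.card : ℝ) * (√w - √((∑ i ∈ s, u i) / s.card)) ^ 2 ≤ ∑ i ∈ s, (√w - √(u i)) ^ 2 := by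
  have hc : (0 : ℝ) < s.card := by exact_mod_cast hs.card_pos
  have h := sq_sqrt_sum_sub_le s (u := fun _ => w) (fun _ => hw) hu
  refine le_trans (le_of_eq ?_) h
  rw [sum_const, nsmul_eq_mul, Real.sqrt_mul hc.le, Real.sqrt_div' _ hc.le]
  have h2 := Real.sq_sqrt hc.le
  have h3 : √(s.card : ℝ) ≠ 0 := by positivity
  set c := √(s.card : ℝ)
  rw [← h2]
  field_simp

/-- Superadditivity of relative entropy over independent uniform bits. -/
theorem sum_half_sq_sqrt_sub_le {K : Type*} [Fintype K] [DecidableEq K] (f : (K → Bool) → ℝ)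
    (hf : ∀ s, 0 ≤ f s) {M : ℝ} (hM : 0 ≤ M) (h0 : M = 0 → ∀ s, f s = 0) :
    ∑ s, f s - 2 ^ Fintype.card K * M +
      ∑ l, (√(∑ s with s l = false, f s) - √(∑ s with s l = true, f s)) ^ 2 / 2 ≤
      ∑ s, f s * Real.log (f s / M) := by
  set F := ∑ s, f s with hF
  set G : K → Bool → ℝ := fun l c => ∑ s with s l = c, f s with hG
  have hG0 : ∀ l c, 0 ≤ G l c := fun l c => sum_nonneg fun s _ => hf s
  have hGF : ∀ l, G l false + G l true = F := fun l => by
    have := sum_fiberwise (s := (univ : Finset (K → Bool))) (fun s => s l) f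
    rw [Fintype.sum_bool] at this
    rw [hF, ← this, add_comm]
  have hle : ∀ s l, f s ≤ G l (s l) := fun s l =>
    single_le_sum (f := f) (fun s _ => hf s) (by simp)
  have hF0 : 0 ≤ F := sum_nonneg fun s _ => hf s
  rcases hF0.eq_or_lt with h | hFpos
  · have hs : ∀ s, f s = 0 := fun s =>
      (sum_eq_zero_iff_of_nonneg fun s _ => hf s).1 h.symm s (mem_univ _)
    have hg : ∀ l c, G l c = 0 := fun l c => sum_eq_zero fun s _ => hs s
    change F - _ + ∑ l, (√(G l false) - √(G l true)) ^ 2 / 2 ≤ _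
    have hM' : 0 ≤ 2 ^ Fintype.card K * M := by positivity
    simpa [hg, hs, ← h] using hM'
  have hMpos : 0 < M := hM.lt_of_ne fun h => hFpos.ne' <| by
    rw [hF]; exact sum_eq_zero fun s _ => h0 h.symm s
  set n := Fintype.card K
  -- The product of the marginals of `f`, with the same total mass `F`. Then `log (f / M)` splits
  -- into `log (f / g)`, a total-mass term and one binary divergence per coordinate. Nothing is
  -- normalized here; the linear terms in the statement cancel once transcripts are summed.
  set g : (K → Bool) → ℝ := fun s => F / 2 ^ n * ∏ l, (2 * G l (s l) / F) with hg
  have hg0 : ∀ s, 0 ≤ g s := fun s => mul_nonneg (by positivity)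
    (prod_nonneg fun l _ => div_nonneg (mul_nonneg zero_le_two (hG0 _ _)) hFpos.le)
  have hprod : ∑ s : K → Bool, ∏ l, (2 * G l (s l) / F) = 2 ^ n := by
    have := prod_univ_sum (fun _ : K => (univ : Finset Bool)) (fun l c => 2 * G l c / F)
    rw [Fintype.piFinset_univ] at this
    rw [← this]
    have : ∀ l, ∑ c, 2 * G l c / F = 2 := fun l => by
      rw [Fintype.sum_bool, ← add_div, ← mul_add, add_comm, hGF]; field_simp
    rw [prod_congr rfl fun l _ => this l]
    simp [n]
  have hsumg : ∑ s, g s = F := by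
    rw [hg, ← mul_sum, hprod]; field_simp
  have key : ∀ s, f s - g s + (f s * Real.log (F / (2 ^ n * M)) +
      ∑ l, f s * Real.log (2 * G l (s l) / F)) ≤ f s * Real.log (f s / M) := by
    intro s
    rcases (hf s).eq_or_lt with h | h
    · rw [← h]; simp [hg0 s]
    have hpos : ∀ l, 0 < 2 * G l (s l) / F := fun l =>
      div_pos (mul_pos two_pos (h.trans_le (hle s l))) hFpos
    have hgpos : 0 < g s := mul_pos (by positivity) (prod_pos fun l _ => hpos l)
    have h1 := sub_le_mul_log (hf s) (hg0 s) fun h' => absurd h' hgpos.ne'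
    have h2 : Real.log (f s / M) = Real.log (f s / g s) + (Real.log (F / (2 ^ n * M)) +
        ∑ l, Real.log (2 * G l (s l) / F)) := by
      rw [← Real.log_prod fun l _ => (hpos l).ne',
        ← Real.log_mul (by positivity) (prod_pos fun l _ => hpos l).ne',
        ← Real.log_mul (div_pos h hgpos).ne'
          (mul_pos (by positivity) (prod_pos fun l _ => hpos l)).ne']
      congr 1
      have := (prod_pos fun l (_ : l ∈ univ) => hpos l).ne'
      rw [hg]
      field_simp
    rw [h2, mul_add, mul_add, mul_sum]
    linarith
  have hsum := sum_le_sum fun s (_ : s ∈ univ) => key s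
  rw [sum_add_distrib, sum_sub_distrib, hsumg, sum_add_distrib, ← sum_mul, ← hF, sum_comm] at hsum
  have h3 := sub_le_mul_log (x := F) (y := 2 ^ n * M) hFpos.le (by positivity)
    fun h => absurd h (by positivity)
  have h4 : ∑ l, (√(G l false) - √(G l true)) ^ 2 / 2 ≤
      ∑ l, ∑ s, f s * Real.log (2 * G l (s l) / F) := by
    refine sum_le_sum fun l _ => ?_
    have := half_sq_sqrt_sub_le_mul_log (hG0 l false) (hG0 l true)
    rw [hGF l] at this
    refine this.trans (le_of_eq ?_)
    rw [← sum_fiberwise (s := (univ : Finset (K → Bool))) (fun s => s l)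
      (fun s => f s * Real.log (2 * G l (s l) / F)), Fintype.sum_bool, add_comm]
    congr 1 <;>
    · rw [sum_mul]
      refine sum_congr rfl fun s hs => ?_
      rw [(mem_filter.1 hs).2]
  change F - _ + ∑ l, (√(G l false) - √(G l true)) ^ 2 / 2 ≤ _
  linarith

/-- The cut-and-paste argument. -/
theorem sum_sq_sub_le_of_cut_paste {ζ : Type*} (S : Finset ζ) (A₁ A₂ A₃ B₁ B₂ B₃ : ζ → ℝ) {Q : ℝ}
    (h11 : ∑ z ∈ S, (A₁ z * B₁ z) ^ 2 = Q) (h12 : ∑ z ∈ S, (A₁ z * B₂ z) ^ 2 = Q)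
    (h13 : ∑ z ∈ S, (A₁ z * B₃ z) ^ 2 = Q) (h21 : ∑ z ∈ S, (A₂ z * B₁ z) ^ 2 = Q)
    (h23 : ∑ z ∈ S, (A₂ z * B₃ z) ^ 2 = Q) (h32 : ∑ z ∈ S, (A₃ z * B₂ z) ^ 2 = Q)
    (h33 : ∑ z ∈ S, (A₃ z * B₃ z) ^ 2 = Q) :
    ∑ z ∈ S, (A₁ z * B₁ z - A₁ z * B₂ z) ^ 2 ≤
      12 * (∑ z ∈ S, (A₁ z * B₁ z - A₂ z * B₁ z) ^ 2 +
        ∑ z ∈ S, (A₁ z * B₂ z - A₃ z * B₂ z) ^ 2) +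
      8 * (∑ z ∈ S, (A₂ z * B₁ z - A₂ z * B₃ z) ^ 2 +
        ∑ z ∈ S, (A₃ z * B₂ z - A₃ z * B₃ z) ^ 2) := by
  -- The cross terms on both sides are the same product `A₁ B₁ A₂ B₃`, and every square sums to `Q`.
  have e1 : ∑ z ∈ S, (A₂ z * B₁ z - A₁ z * B₃ z) ^ 2 =
      ∑ z ∈ S, (A₁ z * B₁ z - A₂ z * B₃ z) ^ 2 := by
    have : ∑ z ∈ S, ((A₂ z * B₁ z - A₁ z * B₃ z) ^ 2 - (A₁ z * B₁ z - A₂ z * B₃ z) ^ 2) =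
        ∑ z ∈ S, ((A₂ z * B₁ z) ^ 2 + (A₁ z * B₃ z) ^ 2 - (A₁ z * B₁ z) ^ 2
          - (A₂ z * B₃ z) ^ 2) := sum_congr rfl fun z _ => by ring
    simp only [sum_sub_distrib, sum_add_distrib] at this
    linarith
  have e2 : ∑ z ∈ S, (A₃ z * B₂ z - A₁ z * B₃ z) ^ 2 =
      ∑ z ∈ S, (A₁ z * B₂ z - A₃ z * B₃ z) ^ 2 := by
    have : ∑ z ∈ S, ((A₃ z * B₂ z - A₁ z * B₃ z) ^ 2 - (A₁ z * B₂ z - A₃ z * B₃ z) ^ 2) =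
        ∑ z ∈ S, ((A₃ z * B₂ z) ^ 2 + (A₁ z * B₃ z) ^ 2 - (A₁ z * B₂ z) ^ 2
          - (A₃ z * B₃ z) ^ 2) := sum_congr rfl fun z _ => by ring
    simp only [sum_sub_distrib, sum_add_distrib] at this
    linarith
  have t2 : ∀ p q r : ℝ, (p - r) ^ 2 ≤ 2 * ((p - q) ^ 2 + (q - r) ^ 2) := fun p q r => by
    nlinarith [sq_nonneg ((p - q) - (q - r))]
  have l1 : ∑ z ∈ S, (A₁ z * B₁ z - A₂ z * B₃ z) ^ 2 ≤
      2 * (∑ z ∈ S, (A₁ z * B₁ z - A₂ z * B₁ z) ^ 2 +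
        ∑ z ∈ S, (A₂ z * B₁ z - A₂ z * B₃ z) ^ 2) := by
    rw [← sum_add_distrib, mul_sum]; exact sum_le_sum fun z _ => t2 _ _ _
  have l2 : ∑ z ∈ S, (A₁ z * B₂ z - A₃ z * B₃ z) ^ 2 ≤
      2 * (∑ z ∈ S, (A₁ z * B₂ z - A₃ z * B₂ z) ^ 2 +
        ∑ z ∈ S, (A₃ z * B₂ z - A₃ z * B₃ z) ^ 2) := by
    rw [← sum_add_distrib, mul_sum]; exact sum_le_sum fun z _ => t2 _ _ _
  -- The path from `A₁B₁` to `A₁B₂` runs through `A₂B₁`, `A₁B₃`, `A₃B₂`, and its four steps cost a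
  -- factor 4. Replacing the two middle steps by `l1` and `l2` gives `4 * (1 + 2) = 12` and `4 * 2 =
  -- 8`.
  have l3 : ∑ z ∈ S, (A₁ z * B₁ z - A₁ z * B₂ z) ^ 2 ≤
      4 * (∑ z ∈ S, (A₁ z * B₁ z - A₂ z * B₁ z) ^ 2 + ∑ z ∈ S, (A₂ z * B₁ z - A₁ z * B₃ z) ^ 2
        + ∑ z ∈ S, (A₃ z * B₂ z - A₁ z * B₃ z) ^ 2 +
        ∑ z ∈ S, (A₁ z * B₂ z - A₃ z * B₂ z) ^ 2) := by
    rw [← sum_add_distrib, ← sum_add_distrib, ← sum_add_distrib, mul_sum]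
    refine sum_le_sum fun z _ => ?_
    have h1 := t2 (A₁ z * B₁ z) (A₁ z * B₃ z) (A₁ z * B₂ z)
    have h2 := t2 (A₁ z * B₁ z) (A₂ z * B₁ z) (A₁ z * B₃ z)
    have h3 := t2 (A₁ z * B₂ z) (A₃ z * B₂ z) (A₁ z * B₃ z)
    have h4 : (A₁ z * B₃ z - A₁ z * B₂ z) ^ 2 = (A₁ z * B₂ z - A₁ z * B₃ z) ^ 2 := by ring
    linarith
  linarith

/-! ### Averaging over transitive families of permutations -/

/-- By transitivity the sum over the group does not depend on the starting point, and each `g`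
permutes `T`. This turns averages over random placements into averages over inputs. -/
theorem card_mul_sum_orbit {G P : Type*} [Group G] [Fintype G] (act : G → P → P)
    (hmul : ∀ g h p, act (g * h) p = act g (act h p)) (hinj : ∀ g, Function.Injective (act g))
    (T : Finset P) (hT : ∀ g, ∀ p ∈ T, act g p ∈ T)
    (htr : ∀ p ∈ T, ∀ q ∈ T, ∃ g, act g p = q) (f : P → ℝ) {p : P} (hp : p ∈ T) :
    (T.card : ℝ) * ∑ g, f (act g p) = Fintype.card G * ∑ q ∈ T, f q := by
  classical
  have h1 : ∀ q ∈ T, ∑ g, f (act g q) = ∑ g, f (act g p) := by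
    intro q hq
    obtain ⟨h, rfl⟩ := htr p hp q hq
    simp_rw [← hmul]
    exact Fintype.sum_equiv (Equiv.mulRight h) _ _ fun g => rfl
  have h2 : ∀ g, ∑ q ∈ T, f (act g q) = ∑ q ∈ T, f q := by
    intro g
    have : T.image (act g) = T := eq_of_subset_of_card_le
      (image_subset_iff.2 (hT g)) (by rw [card_image_of_injective _ (hinj g)])
    conv_rhs => rw [← this, sum_image fun _ _ _ _ h => hinj g h]
  rw [← nsmul_eq_mul, ← sum_const, ← sum_congr rfl h1, sum_comm, sum_congr rfl fun g _ => h2 g]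
  simp

/-- Supplies transitivity below, where configurations of the same shape are encoded as colourings;
the permutation is glued from bijections between the fibres. -/
theorem exists_perm_comp_eq {V κ : Type*} [Fintype V] [DecidableEq κ] (c c' : V → κ)
    (h : ∀ j, #{v | c v = j} = #{v | c' v = j}) :
    ∃ g : Equiv.Perm V, ∀ v, c' (g v) = c v := by
  have e : ∀ j, Nonempty ({v // c v = j} ≃ {v // c' v = j}) := fun j =>
    Fintype.card_eq.1 (by rw [Fintype.card_subtype, Fintype.card_subtype, h])
  refine ⟨((Equiv.sigmaFiberEquiv c).symm.trans
    (Equiv.sigmaCongrRight fun j => (e j).some)).trans (Equiv.sigmaFiberEquiv c'), fun v => ?_⟩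
  exact ((e (c v)).some ⟨v, rfl⟩).2

/-! ### Random placements of a gadget -/

/-- Positions of the gadget: eight single positions, and, for each player and each `l : L`,
a pair of positions of which the player's set contains one. -/
abbrev Pos (L : Type) : Type := Fin 8 ⊕ (Bool × L × Bool)

section Placement

variable {L : Type} [Fintype L] [DecidableEq L] {V : Type} [Fintype V] [DecidableEq V]

instance : DecidableEq (Pos L) := inferInstance

instance : Fintype (Pos L) := inferInstance

/-- The position private to the player `h`. -/
def own (L : Type) (h : Bool) : Pos L := .inl (if h then 3 else 2)

/-- The positions that the player `h` selects from the pairs. -/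
def sel (h : Bool) (s : L → Bool) : Finset (Pos L) := univ.image fun l => .inr (h, l, s l)

/-- The sum of `γ` over the sets of player `h` whose single positions are `A`. -/
def bar (h : Bool) (γ : Finset V → ℝ) (σ : Pos L ≃ V) (A : Finset (Pos L)) : ℝ :=
  ∑ s : L → Bool, γ ((A ∪ sel h s).map σ.toEmbedding)

/-- Pairs of sets of size `k` with exactly one common element. -/
def meetingPairs (V : Type) [Fintype V] [DecidableEq V] (k : ℕ) : Finset (Finset V × Finset V) :=
  univ.filter fun p => p.1.card = k ∧ p.2.card = k ∧ (p.1 ∩ p.2).card = 1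

theorem mem_meetingPairs {k : ℕ} {p : Finset V × Finset V} :
    p ∈ meetingPairs V k ↔ p.1.card = k ∧ p.2.card = k ∧ (p.1 ∩ p.2).card = 1 := by
  simp [meetingPairs]

theorem card_filter_mem_pair {x y : Finset V} (j : Bool × Bool) :
    #{v | (decide (v ∈ x), decide (v ∈ y)) = j} =
      bif j.1 then (bif j.2 then (x ∩ y).card else x.card - (x ∩ y).card)
      else (bif j.2 then y.card - (x ∩ y).card else
        Fintype.card V - (x.card + y.card - (x ∩ y).card)) := by
  obtain ⟨j1, j2⟩ := j
  have hu := card_union_add_card_inter x y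
  cases j1 <;> cases j2 <;> simp only [cond_true, cond_false]
  · rw [show x.card + y.card - (x ∩ y).card = (x ∪ y).card by omega, ← card_compl]
    congr 1; ext v; simp
  · rw [show y.card - (x ∩ y).card = (y \ x).card by rw [card_sdiff]]
    congr 1; ext v; simp; tauto
  · rw [show x.card - (x ∩ y).card = (x \ y).card by rw [card_sdiff, inter_comm]]
    congr 1; ext v; simp
  · congr 1; ext v; simp

theorem sum_equiv_eq_sum_perm {W : Type} [Fintype W] [DecidableEq W] (σ₀ : W ≃ V)
    (F : (W ≃ V) → ℝ) :
    ∑ σ, F σ = ∑ g : Equiv.Perm V, F (σ₀.trans g) :=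
  (Fintype.sum_equiv ⟨fun g => σ₀.trans g, fun σ => σ₀.symm.trans σ,
    fun g => by ext; simp, fun σ => by ext; simp⟩ _ _ fun g => rfl).symm

/-- A random placement of one legal pair is uniform over all legal pairs: the sizes of the four
membership classes determine the orbit. -/
theorem card_mul_sum_map_pair {W : Type} [Fintype W] [DecidableEq W] {k : ℕ} {x y : Finset W}
    (hx : x.card = k) (hy : y.card = k) (hxy : (x ∩ y).card = 1)
    (f : Finset V × Finset V → ℝ) :
    ((meetingPairs V k).card : ℝ) *
        ∑ σ : W ≃ V, f (x.map σ.toEmbedding, y.map σ.toEmbedding) =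
      Fintype.card (W ≃ V) * ∑ p ∈ meetingPairs V k, f p := by
  rcases isEmpty_or_nonempty (W ≃ V) with h | ⟨⟨σ₀⟩⟩
  · simp
  have h1 : Fintype.card (W ≃ V) = Fintype.card (Equiv.Perm V) :=
    Fintype.card_congr (Equiv.equivCongr σ₀ (Equiv.refl V))
  rw [sum_equiv_eq_sum_perm σ₀, h1]
  have := card_mul_sum_orbit (G := Equiv.Perm V)
    (fun g (p : Finset V × Finset V) => (p.1.map g.toEmbedding, p.2.map g.toEmbedding))
    (fun g h p => by
      simp only [map_map]; rfl)
    (fun g p q h => by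
      have := Prod.mk.inj h
      exact Prod.ext (map_injective _ this.1) (map_injective _ this.2))
    (meetingPairs V k)
    (fun g p hp => by
      rw [mem_meetingPairs] at hp ⊢
      simpa [← map_inter] using hp)
    (fun p hp q hq => by
      rw [mem_meetingPairs] at hp hq
      obtain ⟨g, hg⟩ := exists_perm_comp_eq
        (fun v => (decide (v ∈ p.1), decide (v ∈ p.2)))
        (fun v => (decide (v ∈ q.1), decide (v ∈ q.2)))
        (fun j => by
          rw [card_filter_mem_pair, card_filter_mem_pair, hp.1, hp.2.1, hp.2.2,
            hq.1, hq.2.1, hq.2.2])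
      have h1 : ∀ v, v ∈ p.1 ↔ g v ∈ q.1 := fun v => by
        have := (Prod.mk.inj (hg v)).1; simpa using this.symm
      have h2 : ∀ v, v ∈ p.2 ↔ g v ∈ q.2 := fun v => by
        have := (Prod.mk.inj (hg v)).2; simpa using this.symm
      refine ⟨g, Prod.ext ?_ ?_⟩
      · ext v; simp [h1]
      · ext v; simp [h2])
    f (p := (x.map σ₀.toEmbedding, y.map σ₀.toEmbedding))
    (by rw [mem_meetingPairs]; simp [← map_inter, hx, hy, hxy])
  rw [← this]
  simp only [map_map]
  rfl

/-- The positions offered to player `h`: the pair of the private and the shared position, or one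
of the pairs indexed by `L`. -/
def offer (L : Type) (h : Bool) : Option L → Bool → Pos L
  | none, c => bif c then .inl 1 else own L h
  | some l, c => .inr (h, l, c)

/-- The position set of player `h` given by the bits `s`, with the meeting position `0`. -/
def chosen (h : Bool) (s : Option L → Bool) : Finset (Pos L) :=
  insert (.inl 0) (univ.image fun o => offer L h o (s o))

theorem offer_ne_zero (h : Bool) (o : Option L) (c : Bool) : offer L h o c ≠ .inl 0 := by
  cases h <;> cases o <;> cases c <;> simp [offer, own]

theorem offer_injective (h : Bool) {o o' : Option L} {c c' : Bool}
    (H : offer L h o c = offer L h o' c') : o = o' := by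
  cases h <;> cases o <;> cases o' <;> cases c <;> cases c' <;> simp_all [offer, own]

theorem card_chosen (h : Bool) (s : Option L → Bool) :
    (chosen h s).card = Fintype.card L + 2 := by
  rw [chosen, card_insert_of_notMem, card_image_of_injective]
  · simp
  · exact fun o o' H => offer_injective h H
  · simp [offer_ne_zero]

theorem card_sel (h : Bool) (s : L → Bool) : (sel h s).card = Fintype.card L := by
  rw [sel, card_image_of_injective _ fun l l' H => by
    simp only [Sum.inr.injEq, Prod.mk.injEq, true_and] at H
    exact H.1]
  simp

theorem inl_not_mem_sel (j : Fin 8) (h' : Bool) (s : L → Bool) : .inl j ∉ sel h' s := by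
  simp [sel]

theorem card_pair_union_sel {i j : Fin 8} (hij : i ≠ j) (h : Bool) (s : L → Bool) :
    ((({.inl i, .inl j} : Finset (Pos L)) ∪ sel h s)).card = Fintype.card L + 2 := by
  rw [card_union_of_disjoint, card_pair (by simpa using hij), card_sel, add_comm]
  rw [disjoint_left]
  intro p hp
  simp only [mem_insert, mem_singleton] at hp
  rcases hp with rfl | rfl <;> exact inl_not_mem_sel _ _ _

/-- The other player keeps the private position, so every outcome of the coins of both players is a
legal input meeting at position `0` only. -/
theorem chosen_inter (h : Bool) (s : Option L → Bool) (t : L → Bool) :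
    chosen h s ∩ (({.inl 0, own L (!h)} : Finset (Pos L)) ∪ sel (!h) t) = {.inl 0} := by
  ext p
  simp only [chosen, sel, mem_inter, mem_insert, mem_image, mem_univ, true_and, mem_union,
    mem_singleton]
  constructor
  · rintro ⟨rfl | ⟨o, rfl⟩, H⟩
    · rfl
    · exfalso
      cases h <;> cases o <;> cases hs : s none <;> simp_all [offer, own]
  · rintro rfl; simp

/-- A permutation of the positions that exchanges the pair `o` of player `h` with the pair of the
private and the shared position. -/
def exchange (h : Bool) : Option L → Equiv.Perm (Pos L)
  | none => 1
  | some l => Equiv.swap (own L h) (.inr (h, l, false)) * Equiv.swap (.inl 1) (.inr (h, l, true))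

/-- On coin vectors the exchange is a transposition of coordinates that preserves the bits. This is
the symmetry between the special coin and the others. -/
theorem exchange_offer (h : Bool) (o o' : Option L) (c : Bool) :
    exchange h o (offer L h o' c) = offer L h (Equiv.swap none o o') c := by
  cases o with
  | none => simp [exchange]
  | some l =>
    cases o' with
    | none => cases h <;> cases c <;> simp [exchange, offer, own, Equiv.swap_apply_def]
    | some l' =>
      by_cases hl : l' = l
      · subst hl
        cases h <;> cases c <;> simp [exchange, offer, own, Equiv.swap_apply_def]
      · cases h <;> cases c <;> simp [exchange, offer, own, Equiv.swap_apply_def, hl]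

theorem exchange_zero (h : Bool) (o : Option L) : exchange h o (.inl 0) = .inl 0 := by
  cases o <;> cases h <;> simp [exchange, own, Equiv.swap_apply_def]

theorem exchange_own_not (h : Bool) (o : Option L) : exchange h o (own L !h) = own L !h := by
  cases o <;> cases h <;> simp [exchange, own, Equiv.swap_apply_def]

theorem exchange_inr_not (h : Bool) (o : Option L) (q : L × Bool) :
    exchange h o (.inr (!h, q)) = .inr (!h, q) := by
  cases o <;> cases h <;> simp [exchange, own, Equiv.swap_apply_def]

theorem map_exchange_chosen (h : Bool) (o : Option L) (s : Option L → Bool) :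
    (chosen h s).map (exchange h o).toEmbedding = chosen h (s ∘ Equiv.swap none o) := by
  rw [map_eq_image, chosen, image_insert, image_image, chosen]
  congr 1
  · exact exchange_zero h o
  · ext p
    simp only [mem_image, mem_univ, true_and, Function.comp]
    constructor
    · rintro ⟨o', rfl⟩
      exact ⟨Equiv.swap none o o', by simp [exchange_offer]⟩
    · rintro ⟨o', rfl⟩
      exact ⟨Equiv.swap none o o', by simp [exchange_offer]⟩

theorem map_exchange_other (h : Bool) (o : Option L) (t : L → Bool) :
    (({.inl 0, own L (!h)} : Finset (Pos L)) ∪ sel (!h) t).map (exchange h o).toEmbedding =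
      {.inl 0, own L (!h)} ∪ sel (!h) t := by
  rw [map_eq_image, image_union, sel, image_image, image_insert, image_singleton]
  simp [exchange_zero, exchange_own_not, Function.comp_def, exchange_inr_not]

theorem chosen_elim (h c : Bool) (s : L → Bool) :
    chosen h (fun o => o.elim c s) = {.inl 0, offer L h none c} ∪ sel h s := by
  ext p
  simp only [chosen, sel, mem_insert, mem_image, mem_univ, true_and, mem_union, mem_singleton,
    Option.exists, Option.elim]
  constructor
  · rintro (H | H | ⟨l, H⟩)
    · exact .inl (.inl H)
    · exact .inl (.inr H.symm)
    · exact .inr ⟨l, H⟩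
  · rintro ((H | H) | ⟨l, H⟩)
    · exact .inl H
    · exact .inr (.inl H.symm)
    · exact .inr (.inr ⟨l, H⟩)

theorem sum_none_eq_bar (h c : Bool) (γ : Finset V → ℝ) (σ : Pos L ≃ V) :
    ∑ s : Option L → Bool with s none = c, γ ((chosen h s).map σ.toEmbedding) =
      bar h γ σ {.inl 0, offer L h none c} := by
  symm
  refine sum_bij' (fun s _ => fun o => o.elim c s) (fun s _ => fun l => s (some l))
    (by simp) (by simp) (by simp) ?_ ?_
  · intro s hs
    rw [mem_filter] at hs
    funext o
    cases o
    · exact hs.2.symm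
    · rfl
  · intro s _
    rw [chosen_elim]

theorem sum_exchange (h c : Bool) (o : Option L) (γ : Finset V → ℝ) (σ : Pos L ≃ V) :
    ∑ s : Option L → Bool with s none = c,
        γ ((chosen h s).map ((exchange h o).trans σ).toEmbedding) =
      ∑ s : Option L → Bool with s o = c, γ ((chosen h s).map σ.toEmbedding) := by
  refine sum_bij' (fun s _ => s ∘ Equiv.swap none o) (fun s _ => s ∘ Equiv.swap none o)
    ?_ ?_ ?_ ?_ ?_
  · intro s hs; simpa using hs
  · intro s hs; simpa using hs
  · intro s _; funext o'; simp
  · intro s _; funext o'; simp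
  · intro s _
    rw [← map_exchange_chosen, map_map]
    rfl

variable {ζ : Type*} (S : Finset ζ) (α β : ζ → Finset V → ℝ)

/-- Up to normalization, the information revealed about the first input given the second,
when the conditional law of the transcript given the second input is `M`. -/
def infoSum (M : ζ → Finset V → ℝ) (p : Finset V × Finset V) : ℝ :=
  ∑ z ∈ S, α z p.1 * β z p.2 * Real.log (α z p.1 * β z p.2 / M z p.2)

/-- Squared Hellinger distance between two single-position choices of player `h`. -/
def moveDist (h : Bool) (σ : Pos L ≃ V) (B A A' : Finset (Pos L)) : ℝ :=
  ∑ z ∈ S, bar (!h) (β z) σ B * (√(bar h (α z) σ A) - √(bar h (α z) σ A')) ^ 2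

/-- A protocol that reveals little information hardly notices the replacement of a private
position by the shared one. -/
theorem card_mul_sum_moveDist_le (hα : ∀ z x, 0 ≤ α z x) (hβ : ∀ z y, 0 ≤ β z y)
    (h1 : ∀ x y, ∑ z ∈ S, α z x * β z y = 1) (M : ζ → Finset V → ℝ) (hM : ∀ z y, 0 ≤ M z y)
    (hM1 : ∀ p ∈ meetingPairs V (Fintype.card L + 2), ∑ z ∈ S, M z p.2 = 1)
    (hM0 : ∀ p ∈ meetingPairs V (Fintype.card L + 2), ∀ z ∈ S, M z p.2 = 0 →
      α z p.1 * β z p.2 = 0) (h : Bool) :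
    ((meetingPairs V (Fintype.card L + 2)).card : ℝ) * ((Fintype.card L + 1) *
        ∑ σ : Pos L ≃ V, moveDist S α β h σ {.inl 0, own L !h} {.inl 0, own L h}
          {.inl 0, .inl 1}) ≤
      Fintype.card (Pos L ≃ V) * 4 ^ (Fintype.card L + 1) *
        ∑ p ∈ meetingPairs V (Fintype.card L + 2), infoSum S α β M p := by
  set n := Fintype.card L with hn
  set yp : (L → Bool) → Finset (Pos L) := fun t => {.inl 0, own L (!h)} ∪ sel (!h) t with hyp
  set G : Option L → Bool → (Pos L ≃ V) → ζ → ℝ := fun o c σ z =>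
    ∑ s : Option L → Bool with s o = c, α z ((chosen h s).map σ.toEmbedding) with hG
  have hG0 : ∀ o c σ z, 0 ≤ G o c σ z := fun o c σ z => sum_nonneg fun _ _ => hα _ _
  set D : Option L → (Pos L ≃ V) → ℝ := fun o σ =>
    ∑ t, ∑ z ∈ S, β z ((yp t).map σ.toEmbedding) *
      (√(G o false σ z) - √(G o true σ z)) ^ 2 with hD
  have hcard : ∀ t, (yp t).card = n + 2 := fun t =>
    card_pair_union_sel (i := 0) (j := if !h then 3 else 2) (by cases h <;> decide) (!h) t
  have hmem : ∀ (σ : Pos L ≃ V) s t, ((chosen h s).map σ.toEmbedding,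
      (yp t).map σ.toEmbedding) ∈ meetingPairs V (n + 2) := by
    intro σ s t
    rw [mem_meetingPairs]
    refine ⟨?_, ?_, ?_⟩
    · simp [card_chosen, hn]
    · rw [card_map, hcard]
    · rw [← map_inter, card_map, chosen_inter, card_singleton]
  have e1 : ∀ σ, ∑ o, D o σ / 2 ≤ ∑ t, ∑ s, infoSum S α β M
      ((chosen h s).map σ.toEmbedding, (yp t).map σ.toEmbedding) := by
    intro σ
    rw [← sum_div, sum_comm, sum_div]
    refine sum_le_sum fun t _ => ?_
    -- Superadditivity over the `n + 1` coins, one transcript at a time. The reference `M` need not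
    -- be the average over the coins: any probability law on transcripts dominating those that occur
    -- will do, since the linear terms then cancel over `S`.
    have key : ∀ z ∈ S, _ := fun z hz => sum_half_sq_sqrt_sub_le
      (fun s => α z ((chosen h s).map σ.toEmbedding) * β z ((yp t).map σ.toEmbedding))
      (fun s => mul_nonneg (hα _ _) (hβ _ _)) (hM z ((yp t).map σ.toEmbedding))
      (fun h0 s => hM0 _ (hmem σ s t) z hz h0)
    have hs := sum_le_sum key
    rw [sum_add_distrib, sum_sub_distrib, ← mul_sum, hM1 _ (hmem σ (fun _ => true) t),
      sum_comm, sum_congr rfl fun s _ => h1 _ _] at hs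
    simp only [infoSum]
    rw [sum_comm (s := univ (α := Option L → Bool)) (t := S)]
    refine le_trans (le_of_eq ?_) hs
    have e0 : ∑ _s : Option L → Bool, (1 : ℝ) - 2 ^ Fintype.card (Option L) * 1 = 0 := by simp
    rw [e0, zero_add, sum_comm, sum_div]
    refine sum_congr rfl fun z _ => ?_
    rw [sum_div]
    refine sum_congr rfl fun o _ => ?_
    rw [← sum_mul, ← sum_mul, Real.sqrt_mul (hG0 o false σ z), Real.sqrt_mul (hG0 o true σ z),
      ← sub_mul, mul_pow, Real.sq_sqrt (hβ _ _), mul_comm]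
  -- Summed over all placements, every coin contributes as much as the special one, by the
  -- substitution `σ ↦ (exchange h o).trans σ`.
  have e2 : ∀ o, ∑ σ, D o σ = ∑ σ, D none σ := by
    intro o
    refine (Fintype.sum_equiv (Equiv.equivCongr (exchange h o).symm (Equiv.refl V)) _ _
      fun σ => ?_)
    have : (Equiv.equivCongr (exchange h o).symm (Equiv.refl V)) σ = (exchange h o).trans σ := by
      ext; simp
    rw [this]
    simp only [hD, hG, sum_exchange]
    refine sum_congr rfl fun t _ => sum_congr rfl fun z _ => ?_
    congr 2
    conv_lhs => rw [hyp]; simp only []; rw [← map_exchange_other h o, map_map]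
    rfl
  have e3 : ∀ σ, D none σ = moveDist S α β h σ {.inl 0, own L !h} {.inl 0, own L h}
      {.inl 0, .inl 1} := by
    intro σ
    simp only [hD, hG, sum_none_eq_bar, moveDist]
    rw [sum_comm]
    refine sum_congr rfl fun z _ => ?_
    rw [← sum_mul]
    rfl
  have e4 : (n + 1 : ℝ) * (∑ σ, D none σ) / 2 ≤ ∑ t, ∑ s, ∑ σ : Pos L ≃ V, infoSum S α β M
      ((chosen h s).map σ.toEmbedding, (yp t).map σ.toEmbedding) := by
    have e := sum_le_sum fun σ (_ : σ ∈ univ) => e1 σ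
    rw [sum_comm, sum_comm (s := univ (α := Pos L ≃ V))] at e
    rw [sum_congr rfl fun t _ => sum_comm (s := univ (α := Pos L ≃ V))] at e
    refine le_trans (le_of_eq ?_) e
    rw [sum_congr rfl fun o _ => (sum_div univ (D o) 2).symm.trans (congrArg (· / 2) (e2 o))]
    simp [hn, mul_div_assoc]
  have e6 : ∀ t s, ((meetingPairs V (n + 2)).card : ℝ) * ∑ σ : Pos L ≃ V, infoSum S α β M
      ((chosen h s).map σ.toEmbedding, (yp t).map σ.toEmbedding) =
      Fintype.card (Pos L ≃ V) * ∑ p ∈ meetingPairs V (n + 2), infoSum S α β M p :=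
    fun t s => card_mul_sum_map_pair (card_chosen h s) (hcard t)
      (by rw [chosen_inter, card_singleton]) _
  have e5 := mul_le_mul_of_nonneg_left e4
    (Nat.cast_nonneg (α := ℝ) (meetingPairs V (n + 2)).card)
  rw [mul_sum univ (fun t => ∑ s, ∑ σ : Pos L ≃ V, infoSum S α β M
      ((chosen h s).map σ.toEmbedding, (yp t).map σ.toEmbedding)),
    sum_congr rfl fun t _ => (mul_sum _ _ _).trans (sum_congr rfl fun s _ => e6 t s)] at e5
  simp_rw [← e3]
  simp only [sum_const, card_univ, Fintype.card_fun, Fintype.card_bool, Fintype.card_option,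
    nsmul_eq_mul, Nat.cast_pow, Nat.cast_ofNat] at e5
  -- There are `2 ^ n` choices of `t` and `2 ^ (n + 1)` of `s`; the remaining 2 undoes the halving
  -- of the Hellinger distance.
  have e7 : (4 : ℝ) ^ (n + 1) = 2 * (2 ^ n * 2 ^ (n + 1)) := by
    rw [show (4 : ℝ) = 2 ^ 2 by norm_num, ← pow_mul]; ring
  rw [e7]
  linarith

end Placement

/-! ### Cut and paste in the gadget, and rerandomizing the second player's set -/

section Placement

variable {L : Type} [Fintype L] [DecidableEq L] {V : Type} [Fintype V] [DecidableEq V]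

theorem bar_nonneg {γ : Finset V → ℝ} (hγ : ∀ x, 0 ≤ γ x) (h : Bool) (σ : Pos L ≃ V)
    (A : Finset (Pos L)) : 0 ≤ bar h γ σ A := sum_nonneg fun _ _ => hγ _

/-- The permutation of the positions that exchanges the meeting position and the shared one. -/
def flip (L : Type) [DecidableEq L] : Equiv.Perm (Pos L) := Equiv.swap (.inl 0) (.inl 1)

theorem map_flip_pair (j : Fin 8) (i : Fin 8) : (({.inl i, .inl j} : Finset (Pos L))).map
    (flip L).toEmbedding = {.inl (Equiv.swap 0 1 i), .inl (Equiv.swap 0 1 j)} := by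
  rw [map_eq_image, image_insert, image_singleton]
  simp only [flip, Equiv.coe_toEmbedding, Equiv.swap_apply_def, Sum.inl.injEq]
  congr 1
  · split_ifs <;> rfl
  · congr 1; split_ifs <;> rfl

theorem bar_flip (h : Bool) (γ : Finset V → ℝ) (σ : Pos L ≃ V) (A : Finset (Pos L)) :
    bar h γ ((flip L).trans σ) A = bar h γ σ (A.map (flip L).toEmbedding) := by
  refine sum_congr rfl fun s _ => congrArg γ ?_
  have : (sel h s).map (flip L).toEmbedding = sel h s := by
    rw [map_eq_image, sel, image_image]
    simp [flip, Function.comp_def, Equiv.swap_apply_def]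
  rw [← congrArg (A.map (flip L).toEmbedding ∪ ·) this, ← map_union, map_map]
  rfl

theorem sum_flip (F : (Pos L ≃ V) → ℝ) : ∑ σ, F ((flip L).trans σ) = ∑ σ, F σ := by
  refine Fintype.sum_equiv (Equiv.equivCongr (flip L).symm (Equiv.refl V)) _ _ fun σ => ?_
  congr 1

variable {ζ : Type*} (S : Finset ζ) (α β : ζ → Finset V → ℝ)

/-- Needed for arbitrary `A` and `B`: cut and paste also uses a pair of sets that meet in two
positions. -/
theorem sum_bar_mul_bar (h1 : ∀ x y, ∑ z ∈ S, α z x * β z y = 1) (σ : Pos L ≃ V)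
    (A B : Finset (Pos L)) :
    ∑ z ∈ S, bar false (α z) σ A * bar true (β z) σ B = 4 ^ Fintype.card L := by
  simp_rw [bar, sum_mul_sum]
  rw [sum_comm]
  simp_rw [sum_comm (s := S), h1]
  rw [show (4 : ℝ) = 2 * 2 by norm_num, mul_pow]
  simp

theorem moveDist_comm (h : Bool) (σ : Pos L ≃ V) (B A A' : Finset (Pos L)) :
    moveDist S α β h σ B A A' = moveDist S α β h σ B A' A :=
  sum_congr rfl fun z _ => by rw [← neg_sub, neg_sq]

theorem moveDist_eq_sum_sq (hβ : ∀ z y, 0 ≤ β z y) (h : Bool)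
    (σ : Pos L ≃ V) (B A A' : Finset (Pos L)) :
    moveDist S α β h σ B A A' = ∑ z ∈ S,
      (√(bar h (α z) σ A) * √(bar (!h) (β z) σ B) -
        √(bar h (α z) σ A') * √(bar (!h) (β z) σ B)) ^ 2 := by
  refine sum_congr rfl fun z _ => ?_
  rw [← sub_mul, mul_pow, Real.sq_sqrt (bar_nonneg (hβ z) _ _ _), mul_comm]

theorem moveDist_eq_sum_sq' (hβ : ∀ z y, 0 ≤ β z y) (h : Bool)
    (σ : Pos L ≃ V) (B A A' : Finset (Pos L)) :
    moveDist S α β h σ B A A' = ∑ z ∈ S,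
      (√(bar (!h) (β z) σ B) * √(bar h (α z) σ A) -
        √(bar (!h) (β z) σ B) * √(bar h (α z) σ A')) ^ 2 := by
  refine sum_congr rfl fun z _ => ?_
  rw [← mul_sub, mul_pow, Real.sq_sqrt (bar_nonneg (hβ z) _ _ _)]

/-- Cut and paste with the single positions `{0,1}`, `{0,2}`, `{1,2}` for Alice and `{0,3}`,
`{1,3}`, `{0,1}` for Bob. The four comparisons on the right exchange a private for the shared
position; two have meeting point `0`, and `flip` brings the two with meeting point `1` to that form.
-/
theorem moveDist_meeting_le (hα : ∀ z x, 0 ≤ α z x) (hβ : ∀ z y, 0 ≤ β z y)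
    (h1 : ∀ x y, ∑ z ∈ S, α z x * β z y = 1) (σ : Pos L ≃ V) :
    moveDist S β α true σ {.inl 0, .inl 1} {.inl 0, .inl 3} {.inl 1, .inl 3} ≤
      12 * (moveDist S α β false σ {.inl 0, .inl 3} {.inl 0, .inl 2} {.inl 0, .inl 1} +
        moveDist S α β false ((flip L).trans σ) {.inl 0, .inl 3} {.inl 0, .inl 2}
          {.inl 0, .inl 1}) +
      8 * (moveDist S β α true σ {.inl 0, .inl 2} {.inl 0, .inl 3} {.inl 0, .inl 1} +
        moveDist S β α true ((flip L).trans σ) {.inl 0, .inl 2} {.inl 0, .inl 3}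
          {.inl 0, .inl 1}) := by
  have hn : ∀ A B, ∑ z ∈ S, (√(bar false (α z) σ A) * √(bar true (β z) σ B)) ^ 2 =
      4 ^ Fintype.card L := fun A B => by
    rw [← sum_bar_mul_bar S α β h1 σ A B]
    refine sum_congr rfl fun z _ => ?_
    rw [mul_pow, Real.sq_sqrt (bar_nonneg (hα z) _ _ _), Real.sq_sqrt (bar_nonneg (hβ z) _ _ _)]
  set A : Fin 8 → Fin 8 → ζ → ℝ := fun i j z => √(bar false (α z) σ {.inl i, .inl j}) with hA
  set B : Fin 8 → Fin 8 → ζ → ℝ := fun i j z => √(bar true (β z) σ {.inl i, .inl j}) with hB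
  have hAB : ∀ i j k l, ∑ z ∈ S, (A i j z * B k l z) ^ 2 = 4 ^ Fintype.card L :=
    fun i j k l => hn _ _
  have key := sum_sq_sub_le_of_cut_paste S (A 0 1) (A 0 2) (A 1 2) (B 0 3) (B 1 3) (B 0 1)
    (hAB _ _ _ _) (hAB _ _ _ _) (hAB _ _ _ _) (hAB _ _ _ _) (hAB _ _ _ _) (hAB _ _ _ _)
    (hAB _ _ _ _)
  rw [moveDist_comm S α β false σ, moveDist_comm S α β false ((flip L).trans σ)]
  simp only [moveDist_eq_sum_sq S α β hβ, moveDist_eq_sum_sq' S β α hα, bar_flip,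
    map_flip_pair, Bool.not_true, Bool.not_false]
  have s0 : Equiv.swap (0 : Fin 8) 1 0 = 1 := by decide
  have s1 : Equiv.swap (0 : Fin 8) 1 1 = 0 := by decide
  have s2 : Equiv.swap (0 : Fin 8) 1 2 = 2 := by decide
  have s3 : Equiv.swap (0 : Fin 8) 1 3 = 3 := by decide
  rw [s0, s1, s2, s3, pair_comm (Sum.inl 1 : Pos L) (Sum.inl 0)]
  exact key

/-- The two players' information controls how well the meeting position can be recognized in
a random gadget. -/
theorem card_mul_sum_moveDist_meeting_le (hα : ∀ z x, 0 ≤ α z x) (hβ : ∀ z y, 0 ≤ β z y)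
    (h1 : ∀ x y, ∑ z ∈ S, α z x * β z y = 1) (MA MB : ζ → Finset V → ℝ)
    (hMA : ∀ z y, 0 ≤ MA z y) (hMB : ∀ z x, 0 ≤ MB z x)
    (hMA1 : ∀ p ∈ meetingPairs V (Fintype.card L + 2), ∑ z ∈ S, MA z p.2 = 1)
    (hMB1 : ∀ p ∈ meetingPairs V (Fintype.card L + 2), ∑ z ∈ S, MB z p.2 = 1)
    (hMA0 : ∀ p ∈ meetingPairs V (Fintype.card L + 2), ∀ z ∈ S, MA z p.2 = 0 →
      α z p.1 * β z p.2 = 0)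
    (hMB0 : ∀ p ∈ meetingPairs V (Fintype.card L + 2), ∀ z ∈ S, MB z p.2 = 0 →
      β z p.1 * α z p.2 = 0) :
    ((meetingPairs V (Fintype.card L + 2)).card : ℝ) * ((Fintype.card L + 1) *
        ∑ σ : Pos L ≃ V, moveDist S β α true σ {.inl 0, .inl 1} {.inl 0, .inl 3}
          {.inl 1, .inl 3}) ≤
      Fintype.card (Pos L ≃ V) * 4 ^ (Fintype.card L + 1) *
        (24 * ∑ p ∈ meetingPairs V (Fintype.card L + 2), infoSum S α β MA p +
        16 * ∑ p ∈ meetingPairs V (Fintype.card L + 2), infoSum S β α MB p) := by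
  have hA := card_mul_sum_moveDist_le (L := L) S α β hα hβ h1 MA hMA hMA1 hMA0 false
  have hB := card_mul_sum_moveDist_le (L := L) S β α hβ hα
    (fun x y => by simp_rw [mul_comm (β _ _)]; exact h1 y x) MB hMB hMB1 hMB0 true
  simp only [own, Bool.not_false, Bool.not_true, if_true] at hA hB
  have hs := sum_le_sum fun σ (_ : σ ∈ univ) =>
    moveDist_meeting_le (L := L) S α β hα hβ h1 σ
  simp only [sum_add_distrib, ← mul_sum] at hs
  -- Flipping only permutes the placements, so flipped and unflipped sums agree and 12, 8 become 24,
  -- 16.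
  rw [sum_flip fun σ => moveDist S α β false σ _ _ _,
    sum_flip fun σ => moveDist S β α true σ _ _ _] at hs
  have := mul_le_mul_of_nonneg_left hs (mul_nonneg (Nat.cast_nonneg (α := ℝ)
    (meetingPairs V (Fintype.card L + 2)).card)
    (add_nonneg (Nat.cast_nonneg (α := ℝ) (Fintype.card L)) zero_le_one))
  simp only [Bool.false_eq_true, if_false] at hA hB
  linarith

/-- The sum of `b` over all sets of size `r + 1` that meet `x` in exactly the point `j`. -/
def meetSum (b : Finset V → ℝ) (r : ℕ) (x : Finset V) (j : V) : ℝ :=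
  ∑ y ∈ powersetCard r xᶜ, b (insert j y)

/-- How well the points `i` and `j` of `x` are distinguished as intersection points. -/
def pointDist (r : ℕ) (q : Finset V × V × V) : ℝ :=
  ∑ z ∈ S, α z q.1 * (√(meetSum (β z) r q.1 q.2.1) - √(meetSum (β z) r q.1 q.2.2)) ^ 2

theorem meetSum_map {W : Type} [Fintype W] [DecidableEq W] (b : Finset V → ℝ) (r : ℕ)
    (x : Finset W) (j : W) (σ : W ≃ V) :
    ∑ q ∈ powersetCard r xᶜ, b ((insert j q).map σ.toEmbedding) =
      meetSum b r (x.map σ.toEmbedding) (σ j) := by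
  have : (x.map σ.toEmbedding)ᶜ = xᶜ.map σ.toEmbedding := by
    ext v; rw [mem_compl, mem_map_equiv, mem_map_equiv, mem_compl]
  rw [meetSum, this, powersetCard_map, sum_map]
  simp

theorem card_filter_subtype_mem {W : Type} [Fintype W] [DecidableEq W] {x q : Finset W}
    (hq : q ⊆ xᶜ) (j : Bool) :
    #{v : {w // w ∉ x} | decide (v.1 ∈ q) = j} =
      bif j then q.card else Fintype.card {w // w ∉ x} - q.card := by
  have h : #{v : {w // w ∉ x} | v.1 ∈ q} = q.card := by
    have h2 : (q.subtype (· ∉ x)).card = q.card := by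
      rw [card_subtype, filter_true_of_mem fun w hw => by simpa using hq hw]
    rw [← h2]; congr 1; ext v; simp
  cases j
  · have := card_filter_add_card_filter_not (s := (univ : Finset {w // w ∉ x}))
      (fun v => v.1 ∈ q)
    simp only [decide_eq_false_iff_not, cond_false]
    rw [← card_univ]
    omega
  · simpa using h

theorem choose_mul_sum_ofSubtype {W : Type} [Fintype W] [DecidableEq W] {x y : Finset W}
    (hy : y ⊆ xᶜ) (f : Finset W → ℝ) :
    (((xᶜ).card.choose y.card : ℕ) : ℝ) * ∑ g : Equiv.Perm {w // w ∉ x},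
        f (y.map (Equiv.Perm.ofSubtype g).toEmbedding) =
      Fintype.card (Equiv.Perm {w // w ∉ x}) * ∑ q ∈ powersetCard y.card xᶜ, f q := by
  rw [← card_powersetCard]
  refine card_mul_sum_orbit (G := Equiv.Perm {w // w ∉ x})
    (fun g p => p.map (Equiv.Perm.ofSubtype g).toEmbedding) ?_ (fun g => map_injective _)
    _ ?_ ?_ f (mem_powersetCard.2 ⟨hy, rfl⟩)
  · intro g h p
    rw [map_map, _root_.map_mul]; rfl
  · intro g p hp
    rw [mem_powersetCard] at hp ⊢
    refine ⟨fun w hw => ?_, by rw [card_map, hp.2]⟩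
    obtain ⟨v, hv, rfl⟩ := mem_map.1 hw
    have hvx : v ∉ x := by simpa using hp.1 hv
    simp only [Equiv.coe_toEmbedding, mem_compl, Equiv.Perm.ofSubtype_apply_of_mem g hvx]
    exact (g ⟨v, hvx⟩).2
  · intro p hp q hq
    rw [mem_powersetCard] at hp hq
    obtain ⟨g, hg⟩ := exists_perm_comp_eq (V := {w // w ∉ x})
      (fun v => decide (v.1 ∈ p)) (fun v => decide (v.1 ∈ q)) (fun j => by
        rw [card_filter_subtype_mem hp.1, card_filter_subtype_mem hq.1, hp.2, hq.2])
    refine ⟨g, eq_of_subset_of_card_le (fun w hw => ?_) (by rw [card_map, hp.2, hq.2])⟩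
    obtain ⟨v, hv, rfl⟩ := mem_map.1 hw
    have hvx : v ∉ x := by simpa using hp.1 hv
    simp only [Equiv.coe_toEmbedding, Equiv.Perm.ofSubtype_apply_of_mem g hvx]
    have := hg ⟨v, hvx⟩
    simpa [hv] using this

/-- The rest of Bob's set, position `3` with his choices from the pairs, avoids `x`. Rerandomizing
the complement of `x` makes it uniform among sets of its size there, for each `t`, while `x` and the
meeting point stay fixed. -/
theorem sum_ofSubtype_bar (b : Finset V → ℝ) (σ : Pos L ≃ V) (s : L → Bool)
    {x : Finset (Pos L)} (hx : x = {.inl 0, .inl 1} ∪ sel false s) {j : Fin 8}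
    (hj : j = 0 ∨ j = 1) :
    ((xᶜ.card.choose (Fintype.card L + 1) : ℕ) : ℝ) * ∑ g : Equiv.Perm {w // w ∉ x},
        bar true b ((Equiv.Perm.ofSubtype g).trans σ) {.inl j, .inl 3} =
      Fintype.card (Equiv.Perm {w // w ∉ x}) * 2 ^ Fintype.card L *
        meetSum b (Fintype.card L + 1) (x.map σ.toEmbedding) (σ (.inl j)) := by
  have hjx : (.inl j : Pos L) ∈ x := by rcases hj with rfl | rfl <;> simp [hx]
  have hc : ∀ t, (insert (.inl 3) (sel true t) : Finset (Pos L)).card = Fintype.card L + 1 :=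
    fun t => by rw [card_insert_of_notMem (inl_not_mem_sel _ _ _), card_sel]
  have hsub : ∀ t, (insert (.inl 3) (sel true t) : Finset (Pos L)) ⊆ xᶜ := by
    intro t w hw
    rw [mem_compl, hx]
    simp only [sel, mem_insert, mem_image, mem_univ, true_and] at hw
    rcases hw with rfl | ⟨l, rfl⟩ <;> simp [sel]
  have key : ∀ t, _ := fun t => choose_mul_sum_ofSubtype (hsub t)
    (fun q => b ((insert (.inl j) q).map σ.toEmbedding))
  simp only [hc, meetSum_map] at key
  simp only [bar]
  rw [sum_comm, mul_sum]
  have e : ∀ t (g : Equiv.Perm {w // w ∉ x}), (({.inl j, .inl 3} ∪ sel true t :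
      Finset (Pos L))).map ((Equiv.Perm.ofSubtype g).trans σ).toEmbedding =
      (insert (.inl j) ((insert (.inl 3) (sel true t) : Finset (Pos L)).map
        (Equiv.Perm.ofSubtype g).toEmbedding)).map σ.toEmbedding := by
    intro t g
    have h0 : ({.inl j, .inl 3} ∪ sel true t : Finset (Pos L)) =
      insert (.inl j) (insert (.inl 3) (sel true t)) := by simp [insert_union]
    rw [h0, Equiv.trans_toEmbedding, ← map_map]
    have h2 : Equiv.Perm.ofSubtype g (.inl j) = (.inl j : Pos L) :=
      Equiv.Perm.ofSubtype_apply_of_not_mem g (by simpa using hjx)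
    rw [map_insert (Equiv.Perm.ofSubtype g).toEmbedding (.inl j)]
    simp only [Equiv.coe_toEmbedding, h2]
  simp_rw [e, key]
  simp
  ring

end Placement

/-! ### From placements to sums over sets with two marked points -/

section Placement

variable {L : Type} [Fintype L] [DecidableEq L] {V : Type} [Fintype V] [DecidableEq V]

/-- Sets of size `k` with two distinguished distinct elements. -/
def pointTriples (V : Type) [Fintype V] [DecidableEq V] (k : ℕ) : Finset (Finset V × V × V) :=
  univ.filter fun q => q.1.card = k ∧ q.2.1 ∈ q.1 ∧ q.2.2 ∈ q.1 ∧ q.2.1 ≠ q.2.2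

theorem mem_pointTriples {k : ℕ} {q : Finset V × V × V} :
    q ∈ pointTriples V k ↔ q.1.card = k ∧ q.2.1 ∈ q.1 ∧ q.2.2 ∈ q.1 ∧ q.2.1 ≠ q.2.2 := by
  simp [pointTriples]

/-- The orbit of a point under the permutations fixing a triple. -/
def tripleColor (q : Finset V × V × V) (v : V) : Fin 4 :=
  if v = q.2.1 then 0 else if v = q.2.2 then 1 else if v ∈ q.1 then 2 else 3

theorem card_tripleColor {k : ℕ} {q : Finset V × V × V} (hq : q ∈ pointTriples V k) (c : Fin 4) :
    #{v | tripleColor q v = c} = ![1, 1, k - 1 - 1, Fintype.card V - k] c := by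
  obtain ⟨x, i, j⟩ := q
  obtain ⟨hk, hi, hj, hij⟩ := mem_pointTriples.1 hq
  simp only at hk hi hj hij
  have key : ∀ (c : Fin 4), ({v | tripleColor (x, i, j) v = c} : Finset V) =
      ![{i}, {j}, (x.erase i).erase j, xᶜ] c := by
    intro c
    ext v
    by_cases h1 : v = i
    · subst h1
      fin_cases c <;> simp [tripleColor, hi, hij]
    by_cases h2 : v = j
    · subst h2
      fin_cases c <;> simp [tripleColor, hj, h1]
    by_cases h3 : v ∈ x <;> fin_cases c <;> simp [tripleColor, h1, h2, h3]
  rw [key]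
  fin_cases c
  · simp
  · simp
  · change ((x.erase i).erase j).card = k - 1 - 1
    rw [card_erase_of_mem (mem_erase.2 ⟨hij.symm, hj⟩), card_erase_of_mem hi, hk]
  · change (xᶜ).card = _
    rw [card_compl, hk]; rfl

theorem card_mul_sum_map_triple {W : Type} [Fintype W] [DecidableEq W] {k : ℕ} {x : Finset W}
    (hx : x.card = k) {i j : W} (hi : i ∈ x) (hj : j ∈ x) (hij : i ≠ j)
    (f : Finset V × V × V → ℝ) :
    ((pointTriples V k).card : ℝ) *
        ∑ σ : W ≃ V, f (x.map σ.toEmbedding, σ i, σ j) =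
      Fintype.card (W ≃ V) * ∑ q ∈ pointTriples V k, f q := by
  rcases isEmpty_or_nonempty (W ≃ V) with h | ⟨⟨σ₀⟩⟩
  · simp
  have h1 : Fintype.card (W ≃ V) = Fintype.card (Equiv.Perm V) :=
    Fintype.card_congr (Equiv.equivCongr σ₀ (Equiv.refl V))
  rw [sum_equiv_eq_sum_perm σ₀, h1]
  have := card_mul_sum_orbit (G := Equiv.Perm V)
    (fun g (q : Finset V × V × V) => (q.1.map g.toEmbedding, g q.2.1, g q.2.2))
    (fun g h q => by
      simp only [map_map]; rfl)
    (fun g p q h => by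
      simp only [Prod.mk.injEq] at h
      exact Prod.ext (map_injective _ h.1) (Prod.ext (g.injective h.2.1) (g.injective h.2.2)))
    (pointTriples V k)
    (fun g q hq => by
      rw [mem_pointTriples] at hq ⊢
      simpa using hq)
    (fun p hp q hq => by
      obtain ⟨g, hg⟩ := exists_perm_comp_eq (tripleColor p) (tripleColor q)
        (fun c => by rw [card_tripleColor hp, card_tripleColor hq])
      obtain ⟨hp1, hp2, hp3, hp4⟩ := mem_pointTriples.1 hp
      obtain ⟨hq1, hq2, hq3, hq4⟩ := mem_pointTriples.1 hq
      have h0 : ∀ (q : Finset V × V × V) v, tripleColor q v = 0 → v = q.2.1 := fun q v h => by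
        unfold tripleColor at h; split_ifs at h <;> simp_all
      have h1 : ∀ (q : Finset V × V × V) v, tripleColor q v = 1 → v = q.2.2 := fun q v h => by
        unfold tripleColor at h; split_ifs at h <;> simp_all
      have h3 : ∀ (q : Finset V × V × V), q ∈ pointTriples V k →
          ∀ v, tripleColor q v = 3 ↔ v ∉ q.1 := fun q hq v => by
        obtain ⟨-, hq2, hq3, -⟩ := mem_pointTriples.1 hq
        unfold tripleColor
        split_ifs with a b c
        · subst a; simp [hq2]
        · subst b; simp [hq3]
        · simp [c]
        · simp [c]
      refine ⟨g, Prod.ext ?_ (Prod.ext ?_ ?_)⟩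
      · ext v
        have e := hg (g.symm v)
        rw [Equiv.apply_symm_apply] at e
        rw [mem_map_equiv, ← not_iff_not, ← h3 p hp, ← h3 q hq, e]
      · exact h0 q _ (by rw [hg]; simp [tripleColor])
      · exact h1 q _ (by rw [hg]; simp [tripleColor, hp4.symm]))
    f (p := (x.map σ₀.toEmbedding, σ₀ i, σ₀ j))
    (by rw [mem_pointTriples]; simp [hx, hi, hj, hij])
  rw [← this]
  simp only [map_map]
  rfl

theorem sum_meetingPairs (r : ℕ) (f : Finset V × Finset V → ℝ) :
    ∑ p ∈ meetingPairs V (r + 1), f p =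
      ∑ x ∈ powersetCard (r + 1) univ, ∑ i ∈ x, ∑ y ∈ powersetCard r xᶜ, f (x, insert i y) := by
  symm
  simp_rw [sum_sigma']
  refine sum_bij (fun a _ => (a.1, insert a.2.1 a.2.2)) ?_ ?_ ?_ ?_
  · rintro ⟨x, i, y⟩ h
    simp only [mem_sigma, mem_powersetCard] at h
    obtain ⟨⟨-, hx⟩, hi, hy, hyr⟩ := h
    have hxy : ∀ v ∈ y, v ∉ x := fun v hv => by simpa using hy hv
    rw [mem_meetingPairs]
    refine ⟨hx, ?_, ?_⟩
    · rw [card_insert_of_notMem fun h => hxy i h hi, hyr]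
    · rw [card_eq_one]
      refine ⟨i, ?_⟩
      ext v
      simp only [mem_inter, mem_insert, mem_singleton]
      constructor
      · rintro ⟨h1, rfl | h2⟩
        · rfl
        · exact absurd h1 (hxy v h2)
      · rintro rfl; exact ⟨hi, .inl rfl⟩
  · rintro ⟨x, i, y⟩ h ⟨x', i', y'⟩ h' e
    simp only [mem_sigma, mem_powersetCard] at h h'
    obtain ⟨⟨-, hx⟩, hi, hy, hyr⟩ := h
    obtain ⟨⟨-, hx'⟩, hi', hy', hyr'⟩ := h'
    have hxy : ∀ v ∈ y, v ∉ x := fun v hv => by simpa using hy hv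
    have hxy' : ∀ v ∈ y', v ∉ x' := fun v hv => by simpa using hy' hv
    simp only [Prod.mk.injEq] at e
    obtain ⟨rfl, e⟩ := e
    have : i = i' := by
      have : i ∈ insert i' y' := e ▸ mem_insert_self i y
      rcases mem_insert.1 this with h | h
      · exact h
      · exact absurd hi (hxy' i h)
    subst this
    have : y = y' := by
      rw [← erase_insert (fun h => hxy i h hi), e, erase_insert (fun h => hxy' i h hi)]
    subst this
    rfl
  · rintro ⟨x, y⟩ h
    obtain ⟨hx, hy, hxy⟩ := mem_meetingPairs.1 h
    obtain ⟨i, hi⟩ := card_eq_one.1 hxy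
    have hi' : i ∈ x ∩ y := hi ▸ mem_singleton_self i
    rw [mem_inter] at hi'
    refine ⟨⟨x, i, y.erase i⟩, ?_, ?_⟩
    · simp only [mem_sigma, mem_powersetCard]
      refine ⟨⟨subset_univ _, hx⟩, hi'.1, fun v hv => ?_, ?_⟩
      · rw [mem_compl]
        intro hvx
        rw [mem_erase] at hv
        have : v ∈ x ∩ y := mem_inter.2 ⟨hvx, hv.2⟩
        rw [hi, mem_singleton] at this
        exact hv.1 this
      · simp only at hy
        rw [card_erase_of_mem hi'.2, hy]; rfl
    · simp [insert_erase hi'.2]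
  · rintro ⟨x, i, y⟩ _
    rfl

theorem sum_pointTriples (k : ℕ) (f : Finset V × V × V → ℝ) :
    ∑ q ∈ pointTriples V k, f q =
      ∑ x ∈ powersetCard k univ, ∑ i ∈ x, ∑ j ∈ x.erase i, f (x, i, j) := by
  symm
  simp_rw [sum_sigma']
  refine sum_bij' (fun a _ => (a.1, a.2.1, a.2.2)) (fun q _ => ⟨q.1, q.2.1, q.2.2⟩) ?_ ?_ ?_ ?_ ?_
  · rintro ⟨x, i, j⟩ h
    simp only [mem_sigma, mem_powersetCard, mem_erase] at h
    rw [mem_pointTriples]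
    exact ⟨h.1.2, h.2.1, h.2.2.2, h.2.2.1.symm⟩
  · rintro ⟨x, i, j⟩ h
    obtain ⟨h1, h2, h3, h4⟩ := mem_pointTriples.1 h
    simp only [mem_sigma, mem_powersetCard, mem_erase]
    exact ⟨⟨subset_univ _, h1⟩, h2, h4.symm, h3⟩
  · intros; rfl
  · intros; rfl
  · intros; rfl

/-- In the application `r = n + 1` is the number of coins, so the gain from superadditivity is
absorbed here. It returns as the factor `2 / (r + 1)` in `IsModel.expect_ptd_le`. -/
theorem card_meetingPairs_mul (r : ℕ) :
    ((meetingPairs V (r + 1)).card : ℝ) * r =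
      (pointTriples V (r + 1)).card * ((Fintype.card V - (r + 1)).choose r : ℕ) := by
  have h1 := sum_meetingPairs (V := V) r fun _ => 1
  have h2 := sum_pointTriples (V := V) (r + 1) fun _ => 1
  simp only [sum_const, nsmul_eq_mul, mul_one, card_powersetCard, card_compl] at h1 h2
  rw [h1, h2, sum_mul, sum_mul]
  refine sum_congr rfl fun x hx => ?_
  have hxc := (mem_powersetCard.1 hx).2
  rw [hxc, sum_congr rfl fun i hi => by rw [card_erase_of_mem hi, hxc]]
  simp only [sum_const, nsmul_eq_mul, hxc, Nat.add_sub_cancel]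
  ring

variable {ζ : Type*} (S : Finset ζ) (α β : ζ → Finset V → ℝ)

theorem le_choose_mul_sum_moveDist (hα : ∀ z x, 0 ≤ α z x) (hβ : ∀ z y, 0 ≤ β z y) :
    2 ^ Fintype.card L * ∑ s : L → Bool, ∑ σ : Pos L ≃ V,
        pointDist S α β (Fintype.card L + 1)
          ((({.inl 0, .inl 1} ∪ sel false s : Finset (Pos L))).map σ.toEmbedding,
            σ (.inl 0), σ (.inl 1)) ≤
      ((Fintype.card V - (Fintype.card L + 2)).choose (Fintype.card L + 1) : ℕ) *
        ∑ σ : Pos L ≃ V, moveDist S β α true σ {.inl 0, .inl 1} {.inl 0, .inl 3}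
          {.inl 1, .inl 3} := by
  rcases isEmpty_or_nonempty (Pos L ≃ V) with h | ⟨⟨σ₀⟩⟩
  · simp
  rw [← Fintype.card_congr σ₀]
  set n := Fintype.card L with hn
  set c : ℕ := (Fintype.card (Pos L) - (n + 2)).choose (n + 1) with hc
  have e1 : ∀ σ : Pos L ≃ V, moveDist S β α true σ {.inl 0, .inl 1} {.inl 0, .inl 3}
      {.inl 1, .inl 3} = ∑ s : L → Bool, ∑ z ∈ S,
        α z ((({.inl 0, .inl 1} ∪ sel false s : Finset (Pos L))).map σ.toEmbedding) *
        (√(bar true (β z) σ {.inl 0, .inl 3}) - √(bar true (β z) σ {.inl 1, .inl 3})) ^ 2 := by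
    intro σ
    rw [moveDist, sum_comm]
    refine sum_congr rfl fun z _ => ?_
    rw [Bool.not_true, bar, sum_mul]
  simp_rw [e1]
  rw [sum_comm (s := univ (α := Pos L ≃ V)), mul_sum, mul_sum]
  refine sum_le_sum fun s _ => ?_
  generalize hx : ({.inl 0, .inl 1} ∪ sel false s : Finset (Pos L)) = x
  have hxc : xᶜ.card = Fintype.card (Pos L) - (n + 2) := by
    rw [card_compl, ← hx, card_pair_union_sel (by decide)]
  set F : (Pos L ≃ V) → ℝ := fun σ => ∑ z ∈ S, α z (x.map σ.toEmbedding) *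
    (√(bar true (β z) σ {.inl 0, .inl 3}) - √(bar true (β z) σ {.inl 1, .inl 3})) ^ 2 with hF
  set N : ℕ := Fintype.card (Equiv.Perm {w // w ∉ x}) with hN
  have hNpos : (0 : ℝ) < N := by exact_mod_cast Fintype.card_pos
  have e2 : (N : ℝ) * ∑ σ, F σ =
      ∑ σ, ∑ g : Equiv.Perm {w // w ∉ x}, F ((Equiv.Perm.ofSubtype g).trans σ) := by
    have h : ∀ g : Equiv.Perm {w // w ∉ x},
        ∑ σ, F ((Equiv.Perm.ofSubtype g).trans σ) = ∑ σ, F σ := fun g =>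
      Fintype.sum_equiv
        (Equiv.equivCongr (Equiv.Perm.ofSubtype g).symm (Equiv.refl V)) _ _ fun σ => rfl
    rw [sum_comm (t := univ (α := Equiv.Perm {w // w ∉ x})), sum_congr rfl fun g _ => h g, sum_const, card_univ, nsmul_eq_mul]
  -- Rerandomizing outside `x` leaves the weight `α z x` unchanged, so joint convexity moves the sum
  -- over `g` inside the square roots.
  have e3 : ∀ σ, N * (2 ^ n * pointDist S α β (n + 1)
      (x.map σ.toEmbedding, σ (.inl 0), σ (.inl 1))) ≤
      c * ∑ g : Equiv.Perm {w // w ∉ x}, F ((Equiv.Perm.ofSubtype g).trans σ) := by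
    intro σ
    have hmap : ∀ g : Equiv.Perm {w // w ∉ x},
        x.map ((Equiv.Perm.ofSubtype g).trans σ).toEmbedding = x.map σ.toEmbedding := by
      intro g
      rw [Equiv.trans_toEmbedding, ← map_map]
      congr 1
      refine eq_of_subset_of_card_le (fun w hw => ?_) (by rw [card_map])
      obtain ⟨v, hv, rfl⟩ := mem_map.1 hw
      rw [Equiv.coe_toEmbedding, Equiv.Perm.ofSubtype_apply_of_not_mem g (by simpa using hv)]
      exact hv
    simp only [hF, hmap, pointDist]
    rw [sum_comm (s := univ (α := Equiv.Perm {w // w ∉ x})), mul_sum, mul_sum, mul_sum]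
    refine sum_le_sum fun z _ => ?_
    rw [← mul_sum]
    have j0 := sum_ofSubtype_bar (β z) σ s hx.symm (j := 0) (.inl rfl)
    have j1 := sum_ofSubtype_bar (β z) σ s hx.symm (j := 1) (.inr rfl)
    rw [hxc] at j0 j1
    have hJ := sq_sqrt_sum_sub_le (univ : Finset (Equiv.Perm {w // w ∉ x}))
      (u := fun g => bar true (β z) ((Equiv.Perm.ofSubtype g).trans σ) {.inl 0, .inl 3})
      (v := fun g => bar true (β z) ((Equiv.Perm.ofSubtype g).trans σ) {.inl 1, .inl 3})
      (fun g => bar_nonneg (hβ z) _ _ _) (fun g => bar_nonneg (hβ z) _ _ _)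
    have hJ2 := mul_le_mul_of_nonneg_left hJ (Nat.cast_nonneg (α := ℝ) c)
    have e4 : ∀ {k a b : ℝ}, 0 ≤ k → k * (√a - √b) ^ 2 = (√(k * a) - √(k * b)) ^ 2 := by
      intro k a b hk
      rw [Real.sqrt_mul hk, Real.sqrt_mul hk, ← mul_sub, mul_pow, Real.sq_sqrt hk]
    rw [e4 (Nat.cast_nonneg c), j0, j1, ← e4 (by positivity)] at hJ2
    have := mul_le_mul_of_nonneg_left hJ2 (hα z (x.map σ.toEmbedding))
    linarith
  have e5 := sum_le_sum fun σ (_ : σ ∈ univ) => e3 σ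
  rw [← mul_sum, ← mul_sum, ← mul_sum, ← e2] at e5
  refine le_of_mul_le_mul_left ?_ hNpos
  linarith

/-- The information revealed by a protocol controls how well it distinguishes the possible
intersection points given the first player's input. -/
theorem sum_pointDist_le (e : Nonempty (Pos L ≃ V)) (hα : ∀ z x, 0 ≤ α z x)
    (hβ : ∀ z y, 0 ≤ β z y)
    (h1 : ∀ x y, ∑ z ∈ S, α z x * β z y = 1) (MA MB : ζ → Finset V → ℝ)
    (hMA : ∀ z y, 0 ≤ MA z y) (hMB : ∀ z x, 0 ≤ MB z x)
    (hMA1 : ∀ p ∈ meetingPairs V (Fintype.card L + 2), ∑ z ∈ S, MA z p.2 = 1)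
    (hMB1 : ∀ p ∈ meetingPairs V (Fintype.card L + 2), ∑ z ∈ S, MB z p.2 = 1)
    (hMA0 : ∀ p ∈ meetingPairs V (Fintype.card L + 2), ∀ z ∈ S, MA z p.2 = 0 →
      α z p.1 * β z p.2 = 0)
    (hMB0 : ∀ p ∈ meetingPairs V (Fintype.card L + 2), ∀ z ∈ S, MB z p.2 = 0 →
      β z p.1 * α z p.2 = 0) :
    ∑ q ∈ pointTriples V (Fintype.card L + 2), pointDist S α β (Fintype.card L + 1) q ≤
      96 * ∑ p ∈ meetingPairs V (Fintype.card L + 2), infoSum S α β MA p +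
        64 * ∑ p ∈ meetingPairs V (Fintype.card L + 2), infoSum S β α MB p := by
  have u := card_mul_sum_moveDist_meeting_le (L := L) S α β hα hβ h1 MA MB hMA hMB hMA1 hMB1
    hMA0 hMB0
  have l := mul_le_mul_of_nonneg_left (le_choose_mul_sum_moveDist (L := L) S α β hα hβ)
    (Nat.cast_nonneg (α := ℝ) (pointTriples V (Fintype.card L + 2)).card)
  have hc := card_meetingPairs_mul (V := V) (Fintype.card L + 1)
  set n := Fintype.card L with hn
  have hs : ∀ s : L → Bool, _ := fun s => card_mul_sum_map_triple (V := V) (k := n + 2)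
    (x := ({.inl 0, .inl 1} ∪ sel false s : Finset (Pos L))) (i := .inl 0) (j := .inl 1)
    (card_pair_union_sel (by decide) false s) (by simp) (by simp) (by simp)
    (pointDist S α β (n + 1))
  rw [mul_left_comm, mul_sum univ (fun s : L → Bool => _) (_ : ℝ),
    sum_congr rfl fun s _ => hs s] at l
  simp only [sum_const, card_univ, Fintype.card_fun, Fintype.card_bool, nsmul_eq_mul,
    Nat.cast_pow, Nat.cast_ofNat, ← hn] at l
  -- The counting identity makes the upper side of `l` the lower side of `u`. The ratio of `4 ^ (n +
  -- 1)` to `4 ^ n` turns 24, 16 into 96, 64.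
  rw [← mul_assoc (((pointTriples V (n + 2)).card : ℕ) : ℝ), ← hc] at l
  have hpos : (0 : ℝ) < Fintype.card (Pos L ≃ V) := by exact_mod_cast Fintype.card_pos
  have h4 : (0 : ℝ) < Fintype.card (Pos L ≃ V) * 4 ^ n := by positivity
  refine le_of_mul_le_mul_left ?_ h4
  have e2 : (4 : ℝ) ^ n = 2 ^ n * 2 ^ n := by rw [← mul_pow]; norm_num
  have e4 : (4 : ℝ) ^ (n + 1) = 4 * (2 ^ n * 2 ^ n) := by rw [pow_succ, e2]; ring
  rw [e4] at u
  rw [e2]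
  push_cast at l u
  linarith

end Placement

/-! ### Probabilities, entropies and mutual information as expectations -/

section Expect

variable {Ω A B C : Type*} [Fintype Ω] (p : PMF Ω)

theorem sum_toReal : ∑ ω, (p ω).toReal = 1 := by
  rw [← ENNReal.toReal_sum fun ω _ => p.apply_ne_top ω]
  have := p.tsum_coe
  rw [tsum_fintype] at this
  rw [this, ENNReal.toReal_one]

open scoped Classical in
theorem prob_eq_expect (E : Set Ω) : prob p E = expect p fun ω => if ω ∈ E then 1 else 0 := by
  rw [prob, PMF.toOuterMeasure_apply_fintype, ENNReal.toReal_sum]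
  · refine sum_congr rfl fun ω _ => ?_
    by_cases h : ω ∈ E <;> simp [h]
  · intro ω _
    by_cases h : ω ∈ E <;> simp [h, p.apply_ne_top]

theorem prob_nonneg (E : Set Ω) : 0 ≤ prob p E := ENNReal.toReal_nonneg

theorem prob_mono {E F : Set Ω} (h : E ⊆ F) : prob p E ≤ prob p F := by
  classical
  rw [prob_eq_expect, prob_eq_expect]
  refine sum_le_sum fun ω _ => mul_le_mul_of_nonneg_left ?_ ENNReal.toReal_nonneg
  by_cases h1 : ω ∈ E
  · simp [h1, h h1]
  · simp only [h1, if_false]; split_ifs <;> simp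

theorem condProb_nonneg (E F : Set Ω) : 0 ≤ condProb p E F :=
  div_nonneg (prob_nonneg p _) (prob_nonneg p _)

theorem condProb_le_one (E F : Set Ω) : condProb p E F ≤ 1 :=
  div_le_one_of_le₀ (prob_mono p Set.inter_subset_right) (prob_nonneg p _)

theorem expect_sub (f g : Ω → ℝ) :
    expect p (fun ω => f ω - g ω) = expect p f - expect p g := by
  simp [expect, mul_sub, sum_sub_distrib]

/-- The weight of each `b` cancels the denominator of the conditional probability, and null `b`
contribute nothing. Entropy differences can then be taken under one expectation. -/
theorem condEntropy_eq_expect (X : Ω → A) (Y : Ω → B) :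
    condEntropy p X Y = expect p fun ω =>
      Real.logb 2 (1 / condProb p {ω' | X ω' = X ω} {ω' | Y ω' = Y ω}) := by
  classical
  have h : ∀ a b, prob p {ω | Y ω = b} * condProb p {ω | X ω = a} {ω | Y ω = b} =
      expect p fun ω => if X ω = a ∧ Y ω = b then 1 else 0 := by
    intro a b
    have h1 : prob p ({ω | X ω = a} ∩ {ω | Y ω = b}) =
        expect p fun ω => if X ω = a ∧ Y ω = b then 1 else 0 := by
      rw [prob_eq_expect]
      congr 1
      funext ω
      by_cases hX : X ω = a <;> by_cases hY : Y ω = b <;> simp [hX, hY]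
    rw [← h1, condProb]
    by_cases h0 : prob p {ω | Y ω = b} = 0
    · rw [h0, zero_mul]
      exact (le_antisymm ((prob_mono p Set.inter_subset_right).trans h0.le)
        (prob_nonneg p _)).symm
    · field_simp
  simp only [condEntropy, entropyGiven, mul_sum]
  simp_rw [← mul_assoc, h, expect, sum_mul]
  rw [sum_congr rfl fun b _ => sum_comm, sum_comm]
  refine sum_congr rfl fun ω _ => ?_
  rw [sum_eq_single (Y ω), sum_eq_single (X ω)]
  · simp
  · intro a _ ha; simp [ha.symm]
  · simp
  · intro b _ hb; exact sum_eq_zero fun a _ => by simp [hb.symm]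
  · simp

theorem condEntropy_nonneg (X : Ω → A) (Y : Ω → B) : 0 ≤ condEntropy p X Y := by
  classical
  refine sum_nonneg fun b _ => mul_nonneg (prob_nonneg p _) (sum_nonneg fun a _ => ?_)
  have h0 := condProb_nonneg p {ω | X ω = a} {ω | Y ω = b}
  have h1 := condProb_le_one p {ω | X ω = a} {ω | Y ω = b}
  refine mul_nonneg h0 ?_
  rcases h0.eq_or_lt with h | h
  · rw [← h]; simp
  · exact Real.logb_nonneg one_lt_two (by rw [le_div_iff₀ h]; linarith)

end Expect

/-! ### Random pairs of sets together with a transcript -/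

section Model

variable {V : Type} [Fintype V] [DecidableEq V] {ζ : Type*} {Ω : Type*} [Fintype Ω]

/-- `X` and `Y` are a random pair of sets of size `k` with one common element, and `Z` is a
transcript whose conditional law has product form. -/
def IsModel (p : PMF Ω) (Z : Ω → ζ) (X Y : Ω → Finset V) (S : Finset ζ) (α β : ζ → Finset V → ℝ)
    (k : ℕ) (τ : ℝ) : Prop :=
  ∀ F : ζ → Finset V → Finset V → ℝ, expect p (fun ω => F (Z ω) (X ω) (Y ω)) =
    τ * ∑ q ∈ meetingPairs V k, ∑ z ∈ S, α z q.1 * β z q.2 * F z q.1 q.2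

theorem swap_mem_meetingPairs {k : ℕ} {q : Finset V × Finset V} :
    q.swap ∈ meetingPairs V k ↔ q ∈ meetingPairs V k := by
  rw [mem_meetingPairs, mem_meetingPairs, Prod.fst_swap, Prod.snd_swap, inter_comm]
  tauto

theorem sum_meetingPairs_swap (k : ℕ) (f : Finset V × Finset V → ℝ) :
    ∑ q ∈ meetingPairs V k, f q.swap = ∑ q ∈ meetingPairs V k, f q :=
  sum_bij' (fun q _ => q.swap) (fun q _ => q.swap) (fun _ hq => swap_mem_meetingPairs.2 hq)
    (fun _ hq => swap_mem_meetingPairs.2 hq) (fun _ _ => Prod.swap_swap _) (fun _ _ => Prod.swap_swap _)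
    fun _ _ => rfl

variable {p : PMF Ω} {Z : Ω → ζ} {X Y : Ω → Finset V} {S : Finset ζ} {α β : ζ → Finset V → ℝ}
  {k : ℕ} {τ : ℝ}

theorem IsModel.swap (h : IsModel p Z X Y S α β k τ) : IsModel p Z Y X S β α k τ := by
  intro F
  rw [h fun z x y => F z y x, ← sum_meetingPairs_swap]
  simp only [Prod.fst_swap, Prod.snd_swap, mul_comm (β _ _) (α _ _)]

open scoped Classical in
theorem IsModel.prob_eq (h : IsModel p Z X Y S α β k τ) (Q : ζ → Finset V → Finset V → Prop) :
    prob p {ω | Q (Z ω) (X ω) (Y ω)} =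
      τ * ∑ q ∈ meetingPairs V k, ∑ z ∈ S, α z q.1 * β z q.2 *
        if Q z q.1 q.2 then 1 else 0 := by
  rw [prob_eq_expect, ← h fun z x y => if Q z x y then 1 else 0]
  rfl

theorem IsModel.prob_transcript_pair (h : IsModel p Z X Y S α β k τ) {z : ζ} (hz : z ∈ S)
    {q : Finset V × Finset V} (hq : q ∈ meetingPairs V k) :
    prob p ({ω | Z ω = z} ∩ {ω | (X ω, Y ω) = q}) = τ * (α z q.1 * β z q.2) := by
  classical
  have e : ({ω | Z ω = z} ∩ {ω | (X ω, Y ω) = q}) = {ω | Z ω = z ∧ (X ω, Y ω) = q} := rfl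
  rw [e, h.prob_eq fun z' x y => z' = z ∧ (x, y) = q, sum_eq_single q, sum_eq_single z]
  · simp
  · intro z' _ hz'; simp [hz']
  · simp [hz]
  · intro q' _ hq'; exact sum_eq_zero fun z' _ => by simp [hq']
  · simp [hq]

theorem IsModel.prob_pair (h : IsModel p Z X Y S α β k τ)
    (h1 : ∀ x y, ∑ z ∈ S, α z x * β z y = 1) {q : Finset V × Finset V}
    (hq : q ∈ meetingPairs V k) : prob p {ω | (X ω, Y ω) = q} = τ := by
  classical
  rw [h.prob_eq fun _ x y => (x, y) = q, sum_eq_single q]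
  · simp [h1]
  · intro q' _ hq'; exact sum_eq_zero fun z' _ => by simp [hq']
  · simp [hq]

theorem IsModel.condProb_pair (h : IsModel p Z X Y S α β k τ) (hτ : 0 < τ)
    (h1 : ∀ x y, ∑ z ∈ S, α z x * β z y = 1) {z : ζ} (hz : z ∈ S)
    {q : Finset V × Finset V} (hq : q ∈ meetingPairs V k) :
    condProb p {ω | Z ω = z} {ω | (X ω, Y ω) = q} = α z q.1 * β z q.2 := by
  rw [condProb, h.prob_transcript_pair hz hq, h.prob_pair h1 hq, mul_div_cancel_left₀ _ hτ.ne']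

theorem IsModel.sum_condProb (h : IsModel p Z X Y S α β k τ) (hτ : 0 < τ)
    (h1 : ∀ x y, ∑ z ∈ S, α z x * β z y = 1)
    {q : Finset V × Finset V} (hq : q ∈ meetingPairs V k) :
    ∑ z ∈ S, condProb p {ω | Z ω = z} {ω | Y ω = q.2} = 1 := by
  classical
  have hpos : 0 < prob p {ω | Y ω = q.2} := by
    refine (hτ.trans_le (h.prob_pair h1 hq).ge).trans_le (prob_mono p fun ω hω => ?_)
    exact congrArg Prod.snd (Set.mem_ofPred.1 hω)
  simp only [condProb]
  rw [← sum_div, div_eq_one_iff_eq hpos.ne', h.prob_eq fun _ _ y => y = q.2]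
  have e : ∀ z, ({ω | Z ω = z} ∩ {ω | Y ω = q.2}) = {ω | Z ω = z ∧ Y ω = q.2} := fun z => rfl
  simp_rw [e, fun z => h.prob_eq fun z' _ y => z' = z ∧ y = q.2]
  rw [← mul_sum, sum_comm]
  congr 1
  refine sum_congr rfl fun q' _ => ?_
  rw [sum_comm]
  refine sum_congr rfl fun z hz => ?_
  rw [← mul_sum]
  congr 1
  rw [sum_eq_single z]
  · simp
  · intro z' _ hz'; simp [hz'.symm]
  · simp [hz]

theorem IsModel.mul_eq_zero_of_condProb (h : IsModel p Z X Y S α β k τ) (hτ : 0 < τ)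
    (h1 : ∀ x y, ∑ z ∈ S, α z x * β z y = 1) (hα : ∀ z x, 0 ≤ α z x) (hβ : ∀ z y, 0 ≤ β z y)
    {q : Finset V × Finset V} (hq : q ∈ meetingPairs V k) {z : ζ} (hz : z ∈ S)
    (h0 : condProb p {ω | Z ω = z} {ω | Y ω = q.2} = 0) : α z q.1 * β z q.2 = 0 := by
  have hpos : 0 < prob p {ω | Y ω = q.2} := by
    refine (hτ.trans_le (h.prob_pair h1 hq).ge).trans_le (prob_mono p fun ω hω => ?_)
    exact congrArg Prod.snd (Set.mem_ofPred.1 hω)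
  rw [condProb, div_eq_zero_iff, or_iff_left hpos.ne'] at h0
  have hle : τ * (α z q.1 * β z q.2) ≤ 0 := by
    rw [← h.prob_transcript_pair hz hq, ← h0]
    exact prob_mono p fun ω hω => ⟨hω.1, congrArg Prod.snd hω.2⟩
  have := mul_nonneg (hα z q.1) (hβ z q.2)
  nlinarith

/-- Given both sets the transcript has law `α z x * β z y`, so the mutual information is an average
relative entropy to the law given `Y` alone. The factor `log 2` converts bits to natural units. -/
theorem IsModel.condMutualInfo_mul_log (h : IsModel p Z X Y S α β k τ) (hτ : 0 < τ)
    (h1 : ∀ x y, ∑ z ∈ S, α z x * β z y = 1) (hα : ∀ z x, 0 ≤ α z x)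
    (hβ : ∀ z y, 0 ≤ β z y) :
    condMutualInfo p Z X Y * Real.log 2 = τ * ∑ q ∈ meetingPairs V k,
      infoSum S α β (fun z y => condProb p {ω | Z ω = z} {ω | Y ω = y}) q := by
  rw [condMutualInfo, condEntropy_eq_expect, condEntropy_eq_expect, ← expect_sub,
    h fun z x y => Real.logb 2 (1 / condProb p {ω | Z ω = z} {ω | Y ω = y}) -
      Real.logb 2 (1 / condProb p {ω | Z ω = z} {ω | (X ω, Y ω) = (x, y)}),
    mul_assoc, sum_mul]
  congr 1
  refine sum_congr rfl fun q hq => ?_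
  rw [infoSum, sum_mul]
  refine sum_congr rfl fun z hz => ?_
  rw [Prod.mk.eta, h.condProb_pair hτ h1 hz hq]
  rcases (mul_nonneg (hα z q.1) (hβ z q.2)).eq_or_lt with hN | hN
  · simp [← hN]
  have hM : condProb p {ω | Z ω = z} {ω | Y ω = q.2} ≠ 0 := fun h0 =>
    hN.ne' (h.mul_eq_zero_of_condProb hτ h1 hα hβ hq hz h0)
  rw [mul_assoc]
  congr 1
  rw [Real.log_div hN.ne' hM, one_div, one_div, Real.logb_inv, Real.logb_inv, Real.logb, Real.logb]
  have : Real.log 2 ≠ 0 := (Real.log_pos one_lt_two).ne'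
  field_simp
  ring

theorem IsModel.condMutualInfo_nonneg (h : IsModel p Z X Y S α β k τ) (hτ : 0 < τ)
    (h1 : ∀ x y, ∑ z ∈ S, α z x * β z y = 1) (hα : ∀ z x, 0 ≤ α z x)
    (hβ : ∀ z y, 0 ≤ β z y) : 0 ≤ condMutualInfo p Z X Y := by
  refine nonneg_of_mul_nonneg_left ?_ (Real.log_pos one_lt_two)
  rw [h.condMutualInfo_mul_log hτ h1 hα hβ]
  refine mul_nonneg hτ.le (sum_nonneg fun q hq => ?_)
  have := sum_le_sum fun z (hz : z ∈ S) => sub_le_mul_log (mul_nonneg (hα z q.1) (hβ z q.2))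
    (condProb_nonneg p {ω | Z ω = z} {ω | Y ω = q.2})
    (h.mul_eq_zero_of_condProb hτ h1 hα hβ hq hz)
  rw [sum_sub_distrib, h1, h.sum_condProb hτ h1 hq, sub_self] at this
  exact this

variable {r : ℕ}

theorem inter_insert_eq {x y : Finset V} {i : V} (hi : i ∈ x) (hy : y ⊆ xᶜ) :
    x ∩ insert i y = {i} := by
  ext v
  simp only [mem_inter, mem_insert, mem_singleton]
  constructor
  · rintro ⟨h1, rfl | h2⟩
    · rfl
    · exact absurd h1 (by simpa using hy h2)
  · rintro rfl; exact ⟨hi, .inl rfl⟩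

open scoped Classical in
theorem IsModel.prob_point (h : IsModel p Z X Y S α β (r + 1) τ) {x : Finset V}
    (hx : x.card = r + 1) (R : ζ → Finset V → Prop) :
    prob p {ω | X ω = x ∧ R (Z ω) (X ω ∩ Y ω)} =
      τ * ∑ z ∈ S, ∑ i ∈ x, α z x * meetSum (β z) r x i * if R z {i} then 1 else 0 := by
  rw [h.prob_eq fun z x' y => x' = x ∧ R z (x' ∩ y), sum_meetingPairs, sum_eq_single x]
  · rw [sum_comm (s := S)]
    congr 1
    refine sum_congr rfl fun i hi => ?_
    rw [sum_comm]
    refine sum_congr rfl fun z _ => ?_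
    rw [meetSum, mul_sum, sum_mul]
    refine sum_congr rfl fun y hy => ?_
    rw [inter_insert_eq hi (mem_powersetCard.1 hy).1]
    simp
  · intro x' _ hx'
    exact sum_eq_zero fun i _ => sum_eq_zero fun y _ => sum_eq_zero fun z _ => by simp [hx']
  · simp [hx]

theorem sum_mul_meetSum (h1 : ∀ x y, ∑ z ∈ S, α z x * β z y = 1) {x : Finset V}
    (hx : x.card = r + 1) (i : V) :
    ∑ z ∈ S, α z x * meetSum (β z) r x i =
      ((Fintype.card V - (r + 1)).choose r : ℕ) := by
  simp_rw [meetSum, mul_sum]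
  rw [sum_comm, sum_congr rfl fun y _ => h1 _ _]
  simp [card_compl, hx]

/-- Bayes' rule with equally likely pairs; for an impossible `z` both sides are `0` because division
by zero is `0`. -/
theorem IsModel.condProb_point_given (h : IsModel p Z X Y S α β (r + 1) τ) (hτ : 0 < τ)
    {x : Finset V} (hx : x.card = r + 1) {z : ζ} (hz : z ∈ S) (e : V) :
    condProb p {ω | X ω ∩ Y ω = {e}} {ω | Z ω = z ∧ X ω = x} =
      if e ∈ x then α z x * meetSum (β z) r x e / ∑ i ∈ x, α z x * meetSum (β z) r x i else 0 := by
  classical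
  have e1 : {ω | X ω ∩ Y ω = {e}} ∩ {ω | Z ω = z ∧ X ω = x} =
      {ω | X ω = x ∧ (Z ω = z ∧ X ω ∩ Y ω = {e})} := by ext; simp; tauto
  have e2 : {ω | Z ω = z ∧ X ω = x} = {ω | X ω = x ∧ Z ω = z} := by ext; simp [and_comm]
  rw [condProb, e1, e2, h.prob_point hx fun z' s => z' = z ∧ s = {e},
    h.prob_point hx fun z' _ => z' = z, mul_div_mul_left _ _ hτ.ne', sum_eq_single z,
    sum_eq_single z]
  · by_cases he : e ∈ x <;> simp [he]
  · intro z' _ hz'; simp [hz']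
  · simp [hz]
  · intro z' _ hz'; simp [hz']
  · simp [hz]

theorem IsModel.condProb_point (h : IsModel p Z X Y S α β (r + 1) τ) (hτ : 0 < τ)
    (h1 : ∀ x y, ∑ z ∈ S, α z x * β z y = 1)
    (hV : 2 * r + 1 ≤ Fintype.card V) {x : Finset V} (hx : x.card = r + 1) (e : V) :
    condProb p {ω | X ω ∩ Y ω = {e}} {ω | X ω = x} =
      if e ∈ x then 1 / ((r + 1 : ℕ) : ℝ) else 0 := by
  classical
  have e1 : {ω | X ω ∩ Y ω = {e}} ∩ {ω | X ω = x} =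
      {ω | X ω = x ∧ X ω ∩ Y ω = {e}} := by ext; simp; tauto
  have e2 : {ω | X ω = x} = {ω | X ω = x ∧ True} := by simp
  have hc : (((Fintype.card V - (r + 1)).choose r : ℕ) : ℝ) ≠ 0 := by
    exact_mod_cast (Nat.choose_pos (by omega)).ne'
  rw [condProb, e1, e2, h.prob_point hx fun _ s => s = {e},
    h.prob_point hx fun _ _ => True, mul_div_mul_left _ _ hτ.ne', sum_comm, sum_comm (s := S)]
  simp only [if_true, mul_one, sum_mul_meetSum h1 hx, ← sum_mul, sum_const, hx, nsmul_eq_mul,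
    singleton_inj]
  rw [← sum_filter_add_sum_filter_not x (· = e)]
  rw [sum_congr rfl fun i hi => by rw [if_pos (mem_filter.1 hi).2],
    sum_congr (s₁ := x.filter (¬ · = e)) rfl fun i hi => by rw [if_neg (mem_filter.1 hi).2]]
  rw [filter_eq']
  split_ifs
  · simp; field_simp
  · simp

/-- Dropping the restriction to positive differences and passing to Hellinger distance leaves the
distance of each `u e` to the average of `u`, which convexity bounds by the average pairwise
distance. -/
theorem mul_ptd_le {x : Finset V} {u : V → ℝ} (hu : ∀ i, 0 ≤ u i) (hx : x.Nonempty) :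
    (∑ i ∈ x, u i) * ptd (fun e => if e ∈ x then u e / ∑ i ∈ x, u i else 0)
        (fun e => if e ∈ x then 1 / (x.card : ℝ) else 0) ≤
      2 / x.card * ∑ i ∈ x, ∑ j ∈ x, (√(u i) - √(u j)) ^ 2 := by
  classical
  have hc : (0 : ℝ) < x.card := by exact_mod_cast hx.card_pos
  rcases (sum_nonneg fun i _ => hu i : 0 ≤ ∑ i ∈ x, u i).eq_or_lt with h0 | hpos
  · rw [← h0, zero_mul]; positivity
  set n := ∑ i ∈ x, u i with hn
  calc n * ptd (fun e => if e ∈ x then u e / n else 0)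
        (fun e => if e ∈ x then 1 / (x.card : ℝ) else 0)
      ≤ n * ∑ e, 2 * (√(if e ∈ x then u e / n else 0) -
          √(if e ∈ x then 1 / (x.card : ℝ) else 0)) ^ 2 := by
        refine mul_le_mul_of_nonneg_left ?_ hpos.le
        refine le_trans (sum_le_sum fun e _ => sq_sub_div_add_le ?_ ?_)
          (sum_le_sum_of_subset_of_nonneg (filter_subset _ _) fun e _ _ => by positivity)
        · beta_reduce
          split_ifs
          · exact div_nonneg (hu e) hpos.le
          · exact le_rfl
        · beta_reduce; split_ifs <;> positivity
    _ = ∑ e ∈ x, 2 * (√(u e) - √(n / x.card)) ^ 2 := by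
        rw [mul_sum, ← sum_subset (subset_univ x)]
        · refine sum_congr rfl fun e he => ?_
          rw [if_pos he, if_pos he, Real.sqrt_div' _ hpos.le, Real.sqrt_div' _ hc.le,
            Real.sqrt_div' _ hc.le, Real.sqrt_one]
          have h2 := Real.sq_sqrt hpos.le
          have h3 : √n ≠ 0 := by positivity
          have h4 : √(x.card : ℝ) ≠ 0 := by positivity
          conv_lhs => rw [← h2]
          rw [Real.sqrt_sq (Real.sqrt_nonneg n)]
          field_simp
        · intro e _ he
          simp [he]
    _ ≤ 2 / x.card * ∑ i ∈ x, ∑ j ∈ x, (√(u i) - √(u j)) ^ 2 := by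
        rw [mul_sum]
        refine sum_le_sum fun e _ => ?_
        rw [div_mul_eq_mul_div, le_div_iff₀ hc]
        have := card_mul_sq_sqrt_sub_le x hu (hu e) hx
        linarith

/-- The expected triangular discrimination is bounded by the distinguishability of the
possible intersection points. -/
theorem IsModel.expect_ptd_le (h : IsModel p Z X Y S α β (r + 1) τ) (hτ : 0 < τ)
    (h1 : ∀ x y, ∑ z ∈ S, α z x * β z y = 1) (hα : ∀ z x, 0 ≤ α z x)
    (hβ : ∀ z y, 0 ≤ β z y) (hV : 2 * r + 1 ≤ Fintype.card V) :
    expect p (fun ω => ptd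
        (fun e => condProb p {ω' | X ω' ∩ Y ω' = {e}} {ω' | Z ω' = Z ω ∧ X ω' = X ω})
        (fun e => condProb p {ω' | X ω' ∩ Y ω' = {e}} {ω' | X ω' = X ω})) ≤
      τ * (2 / (r + 1 : ℕ) * ∑ q ∈ pointTriples V (r + 1), pointDist S α β r q) := by
  rw [h fun z x _ => ptd (fun e => condProb p {ω' | X ω' ∩ Y ω' = {e}} {ω' | Z ω' = z ∧ X ω' = x})
        (fun e => condProb p {ω' | X ω' ∩ Y ω' = {e}} {ω' | X ω' = x})]
  refine mul_le_mul_of_nonneg_left ?_ hτ.le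
  rw [sum_meetingPairs, sum_pointTriples, mul_sum]
  refine sum_le_sum fun x hx => ?_
  have hxc := (mem_powersetCard.1 hx).2
  have hxn : x.Nonempty := card_pos.1 (by omega)
  have hb : ∀ z i, 0 ≤ meetSum (β z) r x i := fun z i => sum_nonneg fun _ _ => hβ _ _
  have hr : ∀ i ∈ x, ∑ j ∈ x.erase i, pointDist S α β r (x, i, j) =
      ∑ j ∈ x, pointDist S α β r (x, i, j) := fun i hi => by
    rw [← add_sum_erase x _ hi]
    simp [pointDist]
  rw [sum_congr rfl hr]
  calc _ = ∑ z ∈ S, (∑ i ∈ x, α z x * meetSum (β z) r x i) *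
        ptd (fun e => if e ∈ x then α z x * meetSum (β z) r x e /
            ∑ i ∈ x, α z x * meetSum (β z) r x i else 0)
          (fun e => if e ∈ x then 1 / (x.card : ℝ) else 0) := by
        simp only [h.condProb_point hτ h1 hV hxc, hxc]
        simp_rw [sum_mul]
        rw [sum_comm (s := S)]
        refine sum_congr rfl fun i _ => ?_
        rw [sum_comm]
        refine sum_congr rfl fun z hz => ?_
        simp only [h.condProb_point_given hτ hxc hz]
        rw [meetSum, mul_sum, sum_mul]
    _ ≤ ∑ z ∈ S, 2 / x.card * ∑ i ∈ x, ∑ j ∈ x,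
          (√(α z x * meetSum (β z) r x i) - √(α z x * meetSum (β z) r x j)) ^ 2 :=
        sum_le_sum fun z _ => mul_ptd_le (fun i => mul_nonneg (hα z x) (hb z i)) hxn
    _ = _ := by
        rw [← mul_sum, hxc, sum_comm]
        congr 1
        refine sum_congr rfl fun i _ => ?_
        rw [sum_comm]
        refine sum_congr rfl fun j _ => ?_
        refine sum_congr rfl fun z _ => ?_
        rw [Real.sqrt_mul (hα z x), Real.sqrt_mul (hα z x), ← mul_sub, mul_pow,
          Real.sq_sqrt (hα z x)]

/-- A transcript that changes the law of the intersection point given one of the sets reveals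
information about the sets. -/
theorem IsModel.expect_ptd_le_condMutualInfo {L : Type} [Fintype L] [DecidableEq L]
    (e : Nonempty (Pos L ≃ V)) (h : IsModel p Z X Y S α β (Fintype.card L + 2) τ) (hτ : 0 < τ)
    (h1 : ∀ x y, ∑ z ∈ S, α z x * β z y = 1) (hα : ∀ z x, 0 ≤ α z x)
    (hβ : ∀ z y, 0 ≤ β z y) :
    expect p (fun ω => ptd
        (fun e => condProb p {ω' | X ω' ∩ Y ω' = {e}} {ω' | Z ω' = Z ω ∧ X ω' = X ω})
        (fun e => condProb p {ω' | X ω' ∩ Y ω' = {e}} {ω' | X ω' = X ω})) ≤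
      192 / (Fintype.card L + 2) * (condMutualInfo p Z X Y + condMutualInfo p Z Y X) := by
  have h1' : ∀ x y, ∑ z ∈ S, β z x * α z y = 1 := fun x y => by
    simp_rw [mul_comm (β _ _)]; exact h1 y x
  have hV : 2 * (Fintype.card L + 1) + 1 ≤ Fintype.card V := by
    obtain ⟨σ⟩ := e
    rw [← Fintype.card_congr σ]
    simp
    omega
  have b1 := h.expect_ptd_le hτ h1 hα hβ hV
  have b2 := sum_pointDist_le S α β e hα hβ h1
    (fun z y => condProb p {ω | Z ω = z} {ω | Y ω = y})
    (fun z x => condProb p {ω | Z ω = z} {ω | X ω = x})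
    (fun _ _ => condProb_nonneg p _ _) (fun _ _ => condProb_nonneg p _ _)
    (fun q hq => h.sum_condProb hτ h1 hq) (fun q hq => h.swap.sum_condProb hτ h1' hq)
    (fun q hq z hz => h.mul_eq_zero_of_condProb hτ h1 hα hβ hq hz)
    (fun q hq z hz => h.swap.mul_eq_zero_of_condProb hτ h1' hβ hα hq hz)
  have iA := h.condMutualInfo_mul_log hτ h1 hα hβ
  have iB := h.swap.condMutualInfo_mul_log hτ h1' hβ hα
  have nA := h.condMutualInfo_nonneg hτ h1 hα hβ
  have nB := h.swap.condMutualInfo_nonneg hτ h1' hβ hα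
  -- Allows the conversion factor to be dropped; 64 is rounded up to 96, and doubling gives 192.
  have hl : Real.log 2 ≤ 1 := by have := Real.log_two_lt_d9; linarith
  refine b1.trans ?_
  have b3 := mul_le_mul_of_nonneg_left b2 hτ.le
  rw [mul_add, mul_left_comm, mul_left_comm τ, ← iA, ← iB] at b3
  have hk : (0 : ℝ) < Fintype.card L + 2 := by positivity
  have e2 : ((Fintype.card L + 1 + 1 : ℕ) : ℝ) = Fintype.card L + 2 := by push_cast; ring
  rw [e2, mul_left_comm, div_mul_eq_mul_div, div_mul_eq_mul_div]
  refine div_le_div_of_nonneg_right ?_ hk.le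
  nlinarith [mul_le_mul_of_nonneg_left hl nA, mul_le_mul_of_nonneg_left hl nB]

end Model

/-! ### The rectangle property and the law of a protocol -/

section Rectangle

variable {𝒳 𝒴 𝒵 RA RB : Type}

/-- The messages `w` agree with the behaviour of the first player. -/
def Tree.aliceFits : Tree 𝒳 𝒴 RA RB → 𝒳 → RA → List Bool → Prop
  | .leaf, _, _, w => w = []
  | .alice _ _, _, _, [] => False
  | .alice msg next, x, a, c :: w => msg x a = c ∧ (next c).aliceFits x a w
  | .bob _ _, _, _, [] => False
  | .bob _ next, x, a, c :: w => (next c).aliceFits x a w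

/-- The messages `w` agree with the behaviour of the second player. -/
def Tree.bobFits : Tree 𝒳 𝒴 RA RB → 𝒴 → RB → List Bool → Prop
  | .leaf, _, _, w => w = []
  | .alice _ _, _, _, [] => False
  | .alice _ next, y, b, _c :: w => (next _c).bobFits y b w
  | .bob _ _, _, _, [] => False
  | .bob msg next, y, b, c :: w => msg y b = c ∧ (next c).bobFits y b w

/-- The rectangle property: each node constrains only its speaker, so a transcript imposes separate
conditions on `(x, a)` and `(y, b)`. -/
theorem Tree.run_eq_iff (t : Tree 𝒳 𝒴 RA RB) (x : 𝒳) (y : 𝒴) (a : RA) (b : RB)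
    (w : List Bool) : t.run x y a b = w ↔ t.aliceFits x a w ∧ t.bobFits y b w := by
  induction t generalizing w with
  | leaf => simp [Tree.run, Tree.aliceFits, Tree.bobFits, eq_comm]
  | alice msg next ih =>
    cases w with
    | nil => simp [Tree.run, Tree.aliceFits]
    | cons c w =>
      simp only [Tree.run, Tree.aliceFits, Tree.bobFits, List.cons.injEq, ih, and_assoc]
      refine and_congr_right fun h => ?_
      rw [h]
  | bob msg next ih =>
    cases w with
    | nil => simp [Tree.run, Tree.aliceFits]
    | cons c w =>
      simp only [Tree.run, Tree.aliceFits, Tree.bobFits, List.cons.injEq, ih]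
      constructor
      · rintro ⟨rfl, h⟩; exact ⟨h.1, rfl, h.2⟩
      · rintro ⟨h, rfl, h'⟩; exact ⟨rfl, h, h'⟩

namespace Protocol

variable (π : Protocol 𝒳 𝒴 𝒵)

theorem law_apply (D : PMF (𝒳 × 𝒴)) (ω : π.Sample) :
    π.law D ω =
      D ω.1 * (π.pubLaw ω.2.1 * (π.aliceLaw ω.2.2.1 * π.bobLaw ω.2.2.2)) := by
  classical
  obtain ⟨xy, r, a, b⟩ := ω
  have h4 : ∀ xy' r' a', (π.bobLaw.map fun b' => ((xy', r', a', b') : π.Sample)) (xy, r, a, b) =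
      if xy' = xy ∧ r' = r ∧ a' = a then π.bobLaw b else 0 := by
    intro xy' r' a'
    rw [PMF.map_apply, tsum_eq_single b]
    · by_cases h : xy' = xy ∧ r' = r ∧ a' = a
      · obtain ⟨rfl, rfl, rfl⟩ := h; simp
      · rw [if_neg h, if_neg]
        simp only [Prod.mk.injEq, and_true]
        exact fun h' => h ⟨h'.1.symm, h'.2.1.symm, h'.2.2.symm⟩
    · intro b' hb'
      rw [if_neg]
      simp only [Prod.mk.injEq]
      exact fun h' => hb' h'.2.2.2.symm
  simp only [law, PMF.bind_apply, h4]
  rw [tsum_eq_single xy, tsum_eq_single r, tsum_eq_single a]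
  · simp
  · intro a' h; simp [h]
  · intro r' h; simp [h]
  · intro xy' h; simp [h]

open scoped Classical in
/-- The contribution of the first player and of the public randomness to the probability of a
transcript. -/
def aliceWeight (z : π.Pub × List Bool) (x : 𝒳) : ℝ :=
  (π.pubLaw z.1).toReal *
    ∑ a, (π.aliceLaw a).toReal * if (π.tree z.1).aliceFits x a z.2 then 1 else 0

open scoped Classical in
/-- The contribution of the second player to the probability of a transcript. -/
def bobWeight (z : π.Pub × List Bool) (y : 𝒴) : ℝ :=
  ∑ b, (π.bobLaw b).toReal * if (π.tree z.1).bobFits y b z.2 then 1 else 0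

theorem aliceWeight_nonneg (z : π.Pub × List Bool) (x : 𝒳) : 0 ≤ π.aliceWeight z x := by
  refine mul_nonneg ENNReal.toReal_nonneg (sum_nonneg fun a _ =>
    mul_nonneg ENNReal.toReal_nonneg ?_)
  split_ifs <;> simp

theorem bobWeight_nonneg (z : π.Pub × List Bool) (y : 𝒴) : 0 ≤ π.bobWeight z y := by
  refine sum_nonneg fun b _ => mul_nonneg ENNReal.toReal_nonneg ?_
  split_ifs <;> simp

variable [Fintype 𝒳] [Fintype 𝒴]

open scoped Classical in
/-- The set of all possible transcripts. -/
def transcripts : Finset (π.Pub × List Bool) := univ.image π.transcript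

/-- Independence of the private strings lets the product of weights expand into a double sum, in
which each `(r, a, b)` produces exactly one transcript. -/
theorem sum_weights (x : 𝒳) (y : 𝒴) (f : π.Pub × List Bool → ℝ) :
    ∑ z ∈ π.transcripts, π.aliceWeight z x * π.bobWeight z y * f z =
      ∑ r, ∑ a, ∑ b, (π.pubLaw r).toReal * ((π.aliceLaw a).toReal * (π.bobLaw b).toReal) *
        f (r, (π.tree r).run x y a b) := by
  classical
  have h : ∀ z, π.aliceWeight z x * π.bobWeight z y * f z = ∑ a, ∑ b,
      if (π.tree z.1).run x y a b = z.2 then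
        (π.pubLaw z.1).toReal * ((π.aliceLaw a).toReal * (π.bobLaw b).toReal) * f z else 0 := by
    intro z
    rw [aliceWeight, bobWeight, mul_assoc (π.pubLaw z.1).toReal, sum_mul_sum, mul_assoc, sum_mul,
      mul_sum]
    refine sum_congr rfl fun a _ => ?_
    rw [sum_mul, mul_sum]
    refine sum_congr rfl fun b _ => ?_
    by_cases h1 : (π.tree z.1).aliceFits x a z.2 <;> by_cases h2 : (π.tree z.1).bobFits y b z.2 <;>
      simp [Tree.run_eq_iff, h1, h2]
    ring
  simp_rw [h]
  rw [sum_comm, sum_comm (s := univ (α := π.Pub))]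
  refine sum_congr rfl fun a _ => ?_
  rw [sum_comm, sum_comm (s := univ (α := π.Pub))]
  refine sum_congr rfl fun b _ => ?_
  rw [← sum_filter]
  refine sum_bij' (fun z _ => z.1) (fun r _ => (r, (π.tree r).run x y a b)) ?_ ?_ ?_ ?_ ?_
  · intros; simp
  · intro r _
    simp only [mem_filter, and_true, transcripts, mem_image, mem_univ, true_and]
    exact ⟨((x, y), r, a, b), rfl⟩
  · intro z hz
    exact Prod.ext rfl (mem_filter.1 hz).2
  · intros; rfl
  · intro z hz
    rw [(mem_filter.1 hz).2]

theorem sum_weights_eq_one (x : 𝒳) (y : 𝒴) :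
    ∑ z ∈ π.transcripts, π.aliceWeight z x * π.bobWeight z y = 1 := by
  have := π.sum_weights x y fun _ => 1
  simp only [mul_one] at this
  rw [this]
  simp_rw [← mul_sum, sum_toReal, mul_one, sum_toReal, mul_one, sum_toReal]

theorem expect_law (D : PMF (𝒳 × 𝒴)) (F : π.Pub × List Bool → 𝒳 × 𝒴 → ℝ) :
    expect (π.law D) (fun ω => F (π.transcript ω) ω.1) =
      ∑ xy, (D xy).toReal * ∑ z ∈ π.transcripts,
        π.aliceWeight z xy.1 * π.bobWeight z xy.2 * F z xy := by
  rw [expect, Fintype.sum_prod_type]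
  refine sum_congr rfl fun xy _ => ?_
  rw [π.sum_weights xy.1 xy.2 fun z => F z xy, mul_sum, Fintype.sum_prod_type]
  refine sum_congr rfl fun r _ => ?_
  rw [mul_sum, Fintype.sum_prod_type]
  refine sum_congr rfl fun a _ => ?_
  rw [mul_sum]
  refine sum_congr rfl fun b _ => ?_
  rw [law_apply]
  simp only [ENNReal.toReal_mul]
  rw [transcript, messages]
  ring

end Protocol

end Rectangle

/-! ### The hard distribution -/

/-- Each legal pair arises from one outcome only: the common point is `e`, and erasing it recovers
the disjoint sets. Hence the distribution is uniform. -/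
theorem exists_hardDist_apply (m : ℕ) [NeZero m] (hm : 4 ∣ m) :
    ∃ τ : ENNReal, ∀ xy, hardDist m xy = if xy ∈ meetingPairs (Fin m) (m / 4) then τ else 0 := by
  classical
  obtain ⟨k, rfl⟩ := hm
  have hk : 0 < k := by have := NeZero.pos (4 * k); omega
  have hdiv : 4 * k / 4 = k := by omega
  set N : ENNReal := (Fintype.card (DisjointPair (4 * k)) : ENNReal)⁻¹ with hN
  set U : ENNReal := ((4 * k - (k - 1 + (k - 1)) : ℕ) : ENNReal)⁻¹ with hU
  refine ⟨N * U, fun ⟨x, y⟩ => ?_⟩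
  have hcard : ∀ s : DisjointPair (4 * k), ((s.1.1 ∪ s.1.2)ᶜ).card =
      4 * k - (k - 1 + (k - 1)) := by
    rintro ⟨⟨s, t⟩, hs, ht, hd⟩
    rw [card_compl, card_union_of_disjoint hd, Fintype.card_fin]
    simp only at hs ht ⊢
    rw [hs, ht, hdiv]
  have e1 : hardDist (4 * k) (x, y) = ∑ s : DisjointPair (4 * k), ∑ e,
      if e ∈ (s.1.1 ∪ s.1.2)ᶜ ∧ (x, y) = (insert e s.1.1, insert e s.1.2) then N * U else 0 := by
    rw [hardDist, PMF.bind_apply, tsum_fintype]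
    refine sum_congr rfl fun s _ => ?_
    rw [PMF.uniformOfFintype_apply, PMF.map_apply, tsum_fintype, mul_sum]
    refine sum_congr rfl fun e _ => ?_
    rw [PMF.uniformOfFinset_apply, hcard]
    by_cases h1 : e ∈ (s.1.1 ∪ s.1.2)ᶜ <;>
      by_cases h2 : (x, y) = (insert e s.1.1, insert e s.1.2)
    · rw [if_pos h2, if_pos h1, if_pos ⟨h1, h2⟩]
    · rw [if_neg h2, if_neg fun h => h2 h.2, mul_zero]
    · rw [if_pos h2, if_neg h1, if_neg fun h => h1 h.1, mul_zero]
    · rw [if_neg h2, if_neg fun h => h2 h.2, mul_zero]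
  have key : ∀ (s : DisjointPair (4 * k)) e, e ∈ (s.1.1 ∪ s.1.2)ᶜ →
      (x, y) = (insert e s.1.1, insert e s.1.2) →
      x ∩ y = {e} ∧ s.1.1 = x.erase e ∧ s.1.2 = y.erase e := by
    rintro ⟨⟨s, t⟩, hs, ht, hd⟩ e he hxy
    simp only [mem_compl, mem_union, not_or, Prod.mk.injEq] at he hxy ⊢
    obtain ⟨rfl, rfl⟩ := hxy
    refine ⟨?_, (erase_insert he.1).symm, (erase_insert he.2).symm⟩
    rw [← insert_inter_distrib, disjoint_iff_inter_eq_empty.1 hd]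
    simp
  rw [e1, show meetingPairs (Fin (4 * k)) (4 * k / 4) = meetingPairs (Fin (4 * k)) k by rw [hdiv]]
  by_cases hT : (x, y) ∈ meetingPairs (Fin (4 * k)) k
  · rw [if_pos hT]
    obtain ⟨hx, hy, hxy⟩ := mem_meetingPairs.1 hT
    obtain ⟨e, he⟩ := card_eq_one.1 hxy
    simp only at hx hy he
    have hmem : e ∈ x ∩ y := he ▸ mem_singleton_self e
    rw [mem_inter] at hmem
    let s₀ : DisjointPair (4 * k) := ⟨(x.erase e, y.erase e), by
      simp only [hdiv]
      refine ⟨by rw [card_erase_of_mem hmem.1, hx], by rw [card_erase_of_mem hmem.2, hy], ?_⟩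
      rw [disjoint_left]
      intro v hv hv'
      have : v ∈ x ∩ y := mem_inter.2 ⟨mem_of_mem_erase hv, mem_of_mem_erase hv'⟩
      rw [he, mem_singleton] at this
      exact ne_of_mem_erase hv this⟩
    rw [sum_eq_single s₀, sum_eq_single e]
    · rw [if_pos]
      simp [s₀, insert_erase hmem.1, insert_erase hmem.2]
    · intro e' _ hne
      rw [if_neg]
      rintro ⟨h1, h2⟩
      have h3 := (key _ _ h1 h2).1
      rw [he, singleton_inj] at h3
      exact hne h3.symm
    · simp
    · intro s _ hne
      refine sum_eq_zero fun e' _ => if_neg ?_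
      rintro ⟨h1, h2⟩
      obtain ⟨h3, h4, h5⟩ := key _ _ h1 h2
      rw [he, singleton_inj] at h3
      subst h3
      exact hne (Subtype.ext (Prod.ext h4 h5))
    · simp
  · rw [if_neg hT]
    refine sum_eq_zero fun s _ => sum_eq_zero fun e _ => if_neg ?_
    rintro ⟨h1, h2⟩
    obtain ⟨h3, -, -⟩ := key _ _ h1 h2
    refine hT (mem_meetingPairs.2 ?_)
    rw [Prod.mk.injEq] at h2
    simp only [mem_compl, mem_union, not_or] at h1
    simp only
    refine ⟨?_, ?_, by rw [h3, card_singleton]⟩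
    · rw [h2.1, card_insert_of_notMem h1.1, s.2.1, hdiv]; omega
    · rw [h2.2, card_insert_of_notMem h1.2, s.2.2.1, hdiv]; omega

theorem exists_hardDist_toReal (m : ℕ) [NeZero m] (hm : 4 ∣ m) :
    ∃ τ : ℝ, 0 < τ ∧ ∀ xy, (hardDist m xy).toReal =
      if xy ∈ meetingPairs (Fin m) (m / 4) then τ else 0 := by
  obtain ⟨τ, hτ⟩ := exists_hardDist_apply m hm
  obtain ⟨xy, hxy⟩ := (hardDist m).support_nonempty
  rw [PMF.mem_support_iff] at hxy
  have h1 : hardDist m xy = τ := by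
    rw [hτ] at hxy ⊢
    exact if_pos (by_contra fun h => hxy (if_neg h))
  refine ⟨τ.toReal, ?_, fun xy => ?_⟩
  · rw [← h1]
    exact ENNReal.toReal_pos hxy ((hardDist m).apply_ne_top xy)
  · rw [hτ]; split_ifs <;> simp

theorem exists_isModel {m : ℕ} [NeZero m] (hm : 4 ∣ m) (π : SIProtocol m) :
    ∃ τ : ℝ, 0 < τ ∧ IsModel (π.law (hardDist m)) π.transcript π.inA π.inB π.transcripts
      π.aliceWeight π.bobWeight (m / 4) τ := by
  obtain ⟨τ, hpos, hτ⟩ := exists_hardDist_toReal m hm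
  refine ⟨τ, hpos, fun F => ?_⟩
  have := π.expect_law (hardDist m) fun z xy => F z xy.1 xy.2
  refine this.trans ?_
  simp only [hτ, ite_mul, zero_mul]
  rw [← sum_filter, filter_mem_eq_inter, univ_inter, mul_sum]

/-- The information cost of a protocol that internally solves Set-Intersection. -/
theorem le_infoCost_of_internallySolves {m : ℕ} [NeZero m] (hm : 4 ∣ m) {ε : ℝ} (hε : 0 < ε)
    (π : SIProtocol m) (h : π.InternallySolves (hardDist m) ε) :
    1 / 768 * ε * m ≤ π.infoCost (hardDist m) := by
  classical
  obtain ⟨τ, hτ, hmod⟩ := exists_isModel hm π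
  obtain ⟨k, rfl⟩ := hm
  have hk : 0 < k := by have := NeZero.pos (4 * k); omega
  have hdiv : 4 * k / 4 = k := by omega
  rw [hdiv] at hmod
  have h1 := π.sum_weights_eq_one
  have h1' : ∀ x y, ∑ z ∈ π.transcripts, π.bobWeight z x * π.aliceWeight z y = 1 := fun x y => by
    simp_rw [mul_comm (π.bobWeight _ _)]; exact h1 y x
  have hsymm : ∀ F, π.pointLaw (hardDist (4 * k)) F = fun e =>
      condProb (π.law (hardDist (4 * k))) {ω | π.inB ω ∩ π.inA ω = {e}} F := fun F => by
    funext e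
    rw [SIProtocol.pointLaw]
    congr 1
    ext ω
    exact Eq.congr_left (inter_comm _ _)
  obtain rfl | ⟨n, rfl⟩ : k = 1 ∨ ∃ n, k = n + 2 := by
    rcases k with _ | _ | n
    · omega
    · exact .inl rfl
    · exact .inr ⟨n, rfl⟩
  -- For `m = 4` both sets are the singleton `{e*}`, so nothing can be learned and the
  -- discrimination is at most `0 < ε`.
  · exfalso
    have hV : 2 * 0 + 1 ≤ Fintype.card (Fin (4 * 1)) := by simp
    have hT : pointTriples (Fin (4 * 1)) (0 + 1) = ∅ := by
      rw [eq_empty_iff_forall_notMem]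
      intro q hq
      obtain ⟨h1, h2, h3, h4⟩ := mem_pointTriples.1 hq
      obtain ⟨i, hi⟩ := card_eq_one.1 h1
      rw [hi, mem_singleton] at h2 h3
      exact h4 (h2.trans h3.symm)
    have a := IsModel.expect_ptd_le (r := 0) hmod hτ h1 π.aliceWeight_nonneg π.bobWeight_nonneg hV
    have b := IsModel.expect_ptd_le (r := 0) hmod.swap hτ h1' π.bobWeight_nonneg
      π.aliceWeight_nonneg hV
    rw [hT, sum_empty, mul_zero, mul_zero] at a b
    rcases h with h | h
    · exact (hε.trans_le h).not_ge a
    · simp_rw [hsymm] at h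
      exact (hε.trans_le h).not_ge b
  -- `8 + 4 * n = 4 * (n + 2)`; the single positions `4` to `7` lie in no player's set and only make
  -- the count right.
  · have e : Nonempty (Pos (Fin n) ≃ Fin (4 * (n + 2))) := by
      refine Fintype.card_eq.1 ?_
      simp only [Fintype.card_sum, Fintype.card_prod, Fintype.card_bool, Fintype.card_fin]
      ring
    replace hmod : IsModel (π.law (hardDist (4 * (n + 2)))) π.transcript π.inA π.inB π.transcripts
      π.aliceWeight π.bobWeight (Fintype.card (Fin n) + 2) τ := by
      rw [Fintype.card_fin]
      exact hmod
    have a := hmod.expect_ptd_le_condMutualInfo e hτ h1 π.aliceWeight_nonneg π.bobWeight_nonneg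
    have b := hmod.swap.expect_ptd_le_condMutualInfo e hτ h1' π.bobWeight_nonneg
      π.aliceWeight_nonneg
    have key : ε ≤ 192 / (n + 2) * π.infoCost (hardDist (4 * (n + 2))) := by
      rw [Fintype.card_fin] at a b
      rcases h with h | h
      · exact h.trans a
      · simp_rw [hsymm] at h
        refine h.trans (b.trans (le_of_eq ?_))
        exact congrArg (192 / ((n : ℝ) + 2) * ·) (add_comm _ _)
    have hn : (0 : ℝ) < n + 2 := by positivity
    rw [div_mul_eq_mul_div, le_div_iff₀ hn] at key
    push_cast
    linarith

/-! ### The protocol in which the first player sends her whole input -/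

/-- The first player announces, for each element of a list, whether it belongs to her set. -/
def sendTree {m : ℕ} : List (Fin m) → Tree (Finset (Fin m)) (Finset (Fin m)) Unit Unit
  | [] => .leaf
  | i :: l => .alice (fun x _ => decide (i ∈ x)) fun _ => sendTree l

theorem run_sendTree {m : ℕ} (l : List (Fin m)) (x y : Finset (Fin m)) (a b : Unit) :
    (sendTree l).run x y a b = l.map fun i => decide (i ∈ x) := by
  induction l with
  | nil => rfl
  | cons i l ih => simp [sendTree, Tree.run, ih]

/-- The messages of a player who sends the whole set `x`. -/
def encode {m : ℕ} (x : Finset (Fin m)) : List Bool :=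
  (List.finRange m).map fun i => decide (i ∈ x)

theorem encode_injective (m : ℕ) : Function.Injective (encode (m := m)) := by
  intro x x' h
  ext i
  have := List.map_inj_left.1 h i (List.mem_finRange i)
  simpa using this

open scoped Classical in
/-- The unique element of a set that has one. -/
def theElement {m : ℕ} [NeZero m] (s : Finset (Fin m)) : Fin m :=
  if h : ∃ e, s = {e} then h.choose else 0

theorem theElement_singleton {m : ℕ} [NeZero m] (e : Fin m) : theElement {e} = e := by
  have h : ∃ e', ({e} : Finset (Fin m)) = {e'} := ⟨e, rfl⟩
  rw [theElement, dif_pos h]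
  exact (singleton_injective h.choose_spec).symm

/-- The protocol in which the first player sends her whole input. -/
def sendAll (m : ℕ) [NeZero m] : SIProtocol m where
  Pub := Unit
  RA := Unit
  RB := Unit
  pubLaw := PMF.pure ()
  aliceLaw := PMF.pure ()
  bobLaw := PMF.pure ()
  tree := fun _ => sendTree (List.finRange m)
  output := .byBob fun _ w y _ => theElement (Function.invFun encode w ∩ y)

variable {m : ℕ} [NeZero m]

theorem sendAll_messages (ω : (sendAll m).Sample) :
    (sendAll m).messages ω = encode ((sendAll m).inA ω) := run_sendTree _ _ _ _ _

theorem sendAll_transcript (ω : (sendAll m).Sample) :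
    (sendAll m).transcript ω = ((), encode ((sendAll m).inA ω)) :=
  Prod.ext rfl (sendAll_messages ω)

theorem sendAll_transcript_congr {ω ω' : (sendAll m).Sample}
    (h : (sendAll m).inA ω = (sendAll m).inA ω') :
    (sendAll m).transcript ω = (sendAll m).transcript ω' := by
  rw [sendAll_transcript, sendAll_transcript, h]

theorem sendAll_exactlySolves (hm : 4 ∣ m) : (sendAll m).ExactlySolves (hardDist m) := by
  classical
  obtain ⟨τ, hτ, hD⟩ := exists_hardDist_toReal m hm
  have hans : ∀ ω, (sendAll m).answer ω =
      theElement ((sendAll m).inA ω ∩ (sendAll m).inB ω) := by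
    intro ω
    change theElement (Function.invFun encode ((sendAll m).messages ω) ∩ _) = _
    rw [sendAll_messages, Function.leftInverse_invFun (encode_injective m)]
    rfl
  rw [SIProtocol.ExactlySolves, prob_eq_expect]
  refine Eq.trans (sum_congr rfl fun ω _ => ?_) (sum_toReal ((sendAll m).law (hardDist m)))
  by_cases h : ω.1 ∈ meetingPairs (Fin m) (m / 4)
  · obtain ⟨e, he⟩ := card_eq_one.1 (mem_meetingPairs.1 h).2.2
    beta_reduce
    rw [if_pos, mul_one]
    change (sendAll m).inA ω ∩ (sendAll m).inB ω = {(sendAll m).answer ω}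
    have he' : (sendAll m).inA ω ∩ (sendAll m).inB ω = {e} := he
    rw [hans, he', theElement_singleton]
  · have : (((sendAll m).law (hardDist m)) ω).toReal = 0 := by
      rw [Protocol.law_apply, ENNReal.toReal_mul, hD, if_neg h, zero_mul]
    rw [this, zero_mul]

theorem four_pow_inv_le {m : ℕ} {τ : ℝ} (D : PMF (Finset (Fin m) × Finset (Fin m)))
    {T : Finset (Finset (Fin m) × Finset (Fin m))} (hτ : 0 < τ)
    (h : ∀ xy, (D xy).toReal = if xy ∈ T then τ else 0) : 1 / 4 ^ m ≤ τ := by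
  have h1 := sum_toReal D
  simp only [h] at h1
  rw [← sum_filter, filter_mem_eq_inter, univ_inter, sum_const, nsmul_eq_mul] at h1
  have h2 : (T.card : ℝ) ≤ 4 ^ m := by
    have := card_le_univ T
    rw [Fintype.card_prod, Fintype.card_finset, Fintype.card_fin, ← mul_pow] at this
    exact_mod_cast this
  rw [div_le_iff₀ (by positivity), ← h1, mul_comm]
  exact mul_le_mul_of_nonneg_left h2 hτ.le

/-- The transcript is a function of Alice's set, so Bob's set is not revealed. For the other term a
crude bound suffices: given Bob's set, each occurring transcript has probability at least `τ ≥ 1 / 4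
^ m`, hence surprisal at most `2 * m`. -/
theorem sendAll_infoCost_le (hm : 4 ∣ m) : (sendAll m).infoCost (hardDist m) ≤ 2 * m := by
  classical
  obtain ⟨τ, hτ, hD⟩ := exists_hardDist_toReal m hm
  set π := sendAll m with hπ
  set p := π.law (hardDist m) with hp
  have n1 := condEntropy_nonneg p π.transcript fun ω => (π.inA ω, π.inB ω)
  have n2 := condEntropy_nonneg p π.transcript fun ω => (π.inB ω, π.inA ω)
  have e0 : condEntropy p π.transcript π.inA = 0 := by
    rw [condEntropy_eq_expect, expect]
    refine sum_eq_zero fun ω _ => ?_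
    have hsub : {ω' | π.inA ω' = π.inA ω} ⊆ {ω' | π.transcript ω' = π.transcript ω} := by
      exact fun ω' hω' => sendAll_transcript_congr hω'
    rw [condProb, Set.inter_eq_right.2 hsub]
    by_cases h : prob p {ω' | π.inA ω' = π.inA ω} = 0
    · simp [h]
    · simp [div_self h]
  have e1 : condEntropy p π.transcript π.inB ≤ 2 * m := by
    rw [condEntropy_eq_expect]
    calc _ ≤ expect p fun _ => (2 * m : ℝ) := ?_
      _ = 2 * m := by rw [expect, ← sum_mul, sum_toReal, one_mul]
    refine sum_le_sum fun ω _ => ?_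
    by_cases h0 : (p ω).toReal = 0
    · rw [h0, zero_mul, zero_mul]
    refine mul_le_mul_of_nonneg_left ?_ ENNReal.toReal_nonneg
    have hT : ω.1 ∈ meetingPairs (Fin m) (m / 4) := by
      by_contra h
      refine h0 ?_
      rw [hp, Protocol.law_apply, ENNReal.toReal_mul, hD, if_neg h, zero_mul]
    have h1 : τ ≤ condProb p {ω' | π.transcript ω' = π.transcript ω}
        {ω' | π.inB ω' = π.inB ω} := by
      have h2 : prob p {ω' | ω'.1 = ω.1} = τ := by
        rw [prob_eq_expect]
        have := π.expect_law (hardDist m) fun _ xy => if xy = ω.1 then 1 else 0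
        refine Eq.trans ?_ (this.trans ?_)
        · congr 1
          funext ω'
          by_cases h : ω'.1 = ω.1 <;> simp [h]
        rw [sum_eq_single ω.1]
        · simp [π.sum_weights_eq_one, hD, hT]
        · intro xy _ hxy; simp [hxy]
        · simp
      have h3 : prob p {ω' | ω'.1 = ω.1} ≤ prob p ({ω' | π.transcript ω' = π.transcript ω} ∩
          {ω' | π.inB ω' = π.inB ω}) := by
        refine prob_mono p fun ω' hω' => ?_
        have h4 : ω'.1 = ω.1 := hω'
        exact ⟨sendAll_transcript_congr (congrArg Prod.fst h4), congrArg Prod.snd h4⟩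
      have h5 : prob p {ω' | π.inB ω' = π.inB ω} ≤ 1 := by
        rw [prob_eq_expect]
        refine (sum_le_sum fun ω' _ => ?_).trans (sum_toReal p).le
        beta_reduce
        split_ifs <;> simp
      have h6 : 0 < prob p {ω' | π.inB ω' = π.inB ω} :=
        (hτ.trans_le (h2.ge.trans h3)).trans_le (prob_mono p Set.inter_subset_right)
      rw [condProb, le_div_iff₀ h6]
      nlinarith
    have h7 := (four_pow_inv_le (hardDist m) hτ hD).trans h1
    have h8 : (0 : ℝ) < 1 / 4 ^ m := by positivity
    have h9 : 1 / condProb p {ω' | π.transcript ω' = π.transcript ω}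
        {ω' | π.inB ω' = π.inB ω} ≤ 4 ^ m := by
      rw [div_le_iff₀ (h8.trans_le h7)]
      rwa [div_le_iff₀' (by positivity)] at h7
    refine (Real.logb_le_logb_of_le one_lt_two (one_div_pos.2 (h8.trans_le h7)) h9).trans
      (le_of_eq ?_)
    rw [show (4 : ℝ) ^ m = 2 ^ (2 * m) by rw [pow_mul]; norm_num, Real.logb_pow,
      Real.logb_self_eq_one one_lt_two]
    simp
  rw [Protocol.infoCost, condMutualInfo, condMutualInfo]
  linarith

end SetInt

end

theorem mainTheorem5 :
    (∀ γ : ℝ, 0 < γ → γ < 1 → ∃ c : ℝ, 1 ≤ c ∧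
      ∀ (m : ℕ) [NeZero m], 4 ∣ m →
      ∀ (ε : ℝ) (πSI : SetInt.SIProtocol m), 8 / (m : ℝ) ≤ ε →
        SetInt.SIProtocol.InternallySolves πSI (SetInt.hardDist m) ε →
        ∃ π : SetInt.SIProtocol m,
          SetInt.SIProtocol.ExactlySolves π (SetInt.hardDist m) ∧
          π.infoCost (SetInt.hardDist m) ≤
            c / ε * πSI.infoCost (SetInt.hardDist m) + γ * m) ∧
    (∃ c : ℝ, 0 < c ∧
      ∀ (m : ℕ) [NeZero m], 4 ∣ m →
      ∀ (ε : ℝ) (πSI : SetInt.SIProtocol m), 8 / (m : ℝ) ≤ ε →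
        SetInt.SIProtocol.InternallySolves πSI (SetInt.hardDist m) ε →
        c * ε * m ≤ πSI.infoCost (SetInt.hardDist m)) := by
  have hpos : ∀ (m : ℕ) [NeZero m] (ε : ℝ), 8 / (m : ℝ) ≤ ε → 0 < ε := fun m _ ε h =>
    (div_pos (by norm_num) (Nat.cast_pos.2 (NeZero.pos m))).trans_le h
  -- `1536 = 2 * 768` serves for every `γ`: the lower bound alone covers the `2 * m` bits, and `γ *
  -- m` is slack.
  refine ⟨fun γ hγ _ => ⟨1536, by norm_num, fun m _ hm ε πSI hε h => ⟨SetInt.sendAll m,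
    SetInt.sendAll_exactlySolves hm, ?_⟩⟩, 1 / 768, by norm_num, fun m _ hm ε πSI hε h =>
    SetInt.le_infoCost_of_internallySolves hm (hpos m ε hε) πSI h⟩
  have h1 := SetInt.le_infoCost_of_internallySolves hm (hpos m ε hε) πSI h
  have h2 := SetInt.sendAll_infoCost_le hm
  have h3 : 2 * (m : ℝ) ≤ 1536 / ε * πSI.infoCost (SetInt.hardDist m) := by
    rw [div_mul_eq_mul_div, le_div_iff₀ (hpos m ε hε)]
    linarith
  have h4 : 0 ≤ γ * m := by positivity
  linarith
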